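/- Let $k\ge 1$ and $N+1=2k$. For $q=(q_1,\dots,q_{2k})\in\mathbb R^{2k}$, extended $2k$-periodically to $\mathbb Z$, let $\sigma(q)$ be the spectrum of the operator $(Ly)_n=y_{n-1}+y_{n+1}+q_ny_n$ on $\ell^2(\mathbb Z)$. Let $\varphi_n(\lambda,q),\vartheta_n(\lambda,q)$ be the solutions of $y_{n-1}+y_{n+1}+q_ny_n=\lambda y_n$ with $\varphi_0=\vartheta_1=0$, $\varphi_1=\vartheta_0=1$, and let $\Delta(\lambda,q)=\varphi_{2k+1}(\lambda,q)+\vartheta_{2k}(\lambda,q)$ be the Lyapunov function. The zeros of $\Delta(\cdot,q)^2-4$, counted with multiplicity, are real and are written $\lambda_0^+<\lambda_1^-\le\lambda_1^+<\dots<\lambda_{2k-1}^-\le\lambda_{2k-1}^+<\lambda_{2k}^-$; the $n$-th gap is $(\lambda_n^-,\lambda_n^+)$, $1\le n\le 2k-1$. Let $\lambda_n=\lambda_n(q)$ be the unique point of $[\lambda_n^-,\lambda_n^+]$ with $\partial_\lambda\Delta(\lambda_n,q)=0$, and define the height $h_n(q)\ge 0$ by $\Delta(\lambda_n,q)=2(-1)^{2k-n}\cosh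 h_n(q)$. Let $\mathcal Q^{odd}=\{q\in\mathbb R^{2k}: q_{2k+1-n}=-q_n,\ 1\le n\le 2k\}$, with coordinates $q_1,\dots,q_k$, and let $d_q$ denote the derivative with respect to these coordinates. On $\mathcal Q^{odd}$ let $h(q)=(h_n(q))_{n=1}^k$, and let $\Phi(q)\in\mathbb R^k$ be the vector whose $j$-th component ($1\le j\le k$) is the coefficient of $\lambda^{2k-2j}$ in $\Delta(\lambda,q)$. Put $\mathcal S=\{q\in\mathcal Q^{odd}:\det d_q\Phi(q)=0\}$ and $\mathrm{Iso}(q)=\{p\in\mathcal Q^{odd}:\sigma(p)=\sigma(q)\}$. Let $\hat q_m=(q,\hat e_m)$, $1\le m\le k$, be the coordinates of $q\in\mathcal Q^{odd}$ in the orthonormal basis $\hat e_m=2^{-\delta_{k,m}/2}k^{-1/2}\{\sin\frac{(2n-1)m\pi}{2k}\}_{n=1}^{2k}$ of $\mathcal Q^{odd}$. **Theorem.** Let $q\in\mathcal Q^{odd}$. Then: (i) $h$ is differentiable at $q$ with $\det d_qh(q)\ne 0$ if and only if $q\notin\mathcal S$. (ii) If $q\notin\mathcal S$, then $h_n(q)>0$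 for all $n=1,\dots,k$, and all gaps are open, i.e. $\lambda_n^-<\lambda_n^+$ for $n=1,\dots,2k-1$. (iii) If $\hat q_m\ne 0$ for all $m=1,\dots,k$, then there is $\tau=\tau(q)>0$ such that for every $s\in(0,\tau)$ the potential $sq$ is not in $\mathcal S$ and $\mathrm{Iso}(sq)$ has exactly $2^k$ elements. -/

import Mathlib

open Polynomial

namespace OddSchrodinger

/-! ### Potentials

A potential of period `2 * k` is stored as `q : Fin (2 * k) → ℝ`; the entry `q i` is the
value at the site `i + 1`, so that `q 0, …, q (2 * k - 1)` are `q₁, …, q_{2k}`. -/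

/-- The periodic extension `n ↦ q_n`, `n ∈ ℤ`, with `q_{n + 2k} = q_n`. For `0 < k` the second
branch never occurs. -/
def periodicExt {k : ℕ} (q : Fin (2 * k) → ℝ) (n : ℤ) : ℝ :=
  if h : ((n - 1) % ((2 * k : ℕ) : ℤ)).toNat < 2 * k then
    q ⟨((n - 1) % ((2 * k : ℕ) : ℤ)).toNat, h⟩
  else 0

/-- The space of odd potentials: `q_{2k+1-n} = -q_n`. -/
def oddPotentials (k : ℕ) : Submodule ℝ (Fin (2 * k) → ℝ) where
  carrier := {q | ∀ i, q (Fin.rev i) = -q i}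
  add_mem' := by
    intro a b ha hb i
    simp only [Pi.add_apply, ha i, hb i]
    ring
  zero_mem' := by
    intro i
    simp
  smul_mem' := by
    intro c a ha i
    simp [ha i]

/-- The coordinates `(q₁, …, q_k)` of a potential. -/
def firstHalf {k : ℕ} (q : Fin (2 * k) → ℝ) : Fin k → ℝ :=
  fun i => q ⟨i, by omega⟩

/-- The odd potential whose first `k` entries are the given ones. -/
def ofFirstHalf {k : ℕ} (x : Fin k → ℝ) : Fin (2 * k) → ℝ :=
  fun i => if h : (i : ℕ) < k then x ⟨i, h⟩ else -x ⟨2 * k - 1 - i, by omega⟩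

theorem ofFirstHalf_mem {k : ℕ} (x : Fin k → ℝ) : ofFirstHalf x ∈ oddPotentials k := by
  intro i
  have hi := i.isLt
  simp only [ofFirstHalf, Fin.val_rev]
  by_cases h : (i : ℕ) < k
  · rw [dif_pos h, dif_neg (by omega)]
    congr 2
    ext
    simp only
    omega
  · rw [dif_neg h, dif_pos (by omega), neg_neg]
    congr 1
    ext
    simp only
    omega

theorem firstHalf_ofFirstHalf {k : ℕ} (x : Fin k → ℝ) : firstHalf (ofFirstHalf x) = x := by
  ext i
  simp [firstHalf, ofFirstHalf]

theorem ofFirstHalf_firstHalf {k : ℕ} {q : Fin (2 * k) → ℝ} (hq : q ∈ oddPotentials k) :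
    ofFirstHalf (firstHalf q) = q := by
  ext i
  have hi := i.isLt
  simp only [ofFirstHalf, firstHalf]
  by_cases h : (i : ℕ) < k
  · rw [dif_pos h]
  · rw [dif_neg h, ← neg_eq_iff_eq_neg.mpr (hq i)]
    congr 2
    ext
    simp only [Fin.val_rev]
    omega

/-- The entry, at the site `i + 1`, of the `m`-th sine vector
`2^{-δ_{k,m}/2} k^{-1/2} {sin ((2n-1) m π / (2k))}_{n=1}^{2k}`; for `1 ≤ m ≤ k` these vectors
form an orthonormal basis of the space of odd potentials. -/
noncomputable def sineVec (k m : ℕ) (i : Fin (2 * k)) : ℝ :=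
  (if m = k then 1 / √2 else 1) / √(k : ℝ) *
    Real.sin ((2 * ((i : ℝ) + 1) - 1) * m * Real.pi / (2 * k))

/-- The `m`-th coordinate of `q` in the sine basis: the Euclidean scalar product of `q` with the
`m`-th sine vector. -/
noncomputable def sineCoord {k : ℕ} (q : Fin (2 * k) → ℝ) (m : ℕ) : ℝ :=
  ∑ i, q i * sineVec k m i

/-! ### The operator on `ℓ²(ℤ)` and its spectrum -/

/-- The complex Hilbert space `ℓ²(ℤ)`. -/
abbrev Ell2 : Type := lp (fun _ : ℤ => ℂ) 2

theorem memlp_shift (j : ℤ) (y : Ell2) : Memℓp (fun n : ℤ => y (n + j)) 2 := by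
  refine (memℓp_gen_iff (by norm_num)).2 ?_
  exact ((memℓp_gen_iff (by norm_num)).1 (lp.memℓp y)).comp_injective (add_left_injective j)

/-- The shift `(T y)_n = y_{n+j}` on `ℓ²(ℤ)`. -/
noncomputable def shift (j : ℤ) : Ell2 →L[ℂ] Ell2 :=
  LinearMap.mkContinuous
    { toFun := fun y => ⟨fun n => y (n + j), memlp_shift j y⟩
      map_add' := fun y z => by ext n; simp; rfl
      map_smul' := fun c y => by ext n; simp }
    1 (fun y => by
      refine lp.norm_le_of_tsum_le (by norm_num) (by positivity) ?_
      rw [one_mul, lp.norm_rpow_eq_tsum (by norm_num)]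
      exact le_of_eq ((Equiv.addRight j).tsum_eq fun n => ‖y n‖ ^ (2 : ENNReal).toReal))

theorem abs_periodicExt_le {k : ℕ} (q : Fin (2 * k) → ℝ) (n : ℤ) :
    |periodicExt q n| ≤ ∑ i, |q i| := by
  unfold periodicExt
  split_ifs with h
  · exact Finset.single_le_sum (f := fun i => |q i|) (fun i _ => abs_nonneg _)
      (Finset.mem_univ _)
  · simpa using Finset.sum_nonneg fun i _ => abs_nonneg (q i)

theorem norm_potential_mul_le {k : ℕ} (q : Fin (2 * k) → ℝ) (y : Ell2) (n : ℤ) :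
    ‖(periodicExt q n : ℂ) * y n‖ ≤ ‖((∑ i, |q i| : ℝ) : ℂ) * y n‖ := by
  rw [norm_mul, norm_mul, Complex.norm_real, Complex.norm_real, Real.norm_eq_abs,
    Real.norm_eq_abs]
  exact mul_le_mul_of_nonneg_right ((abs_periodicExt_le q n).trans (le_abs_self _))
    (norm_nonneg _)

theorem memlp_mul {k : ℕ} (q : Fin (2 * k) → ℝ) (y : Ell2) :
    Memℓp (fun n : ℤ => (periodicExt q n : ℂ) * y n) 2 := by
  have h := (lp.memℓp y).const_mul ((∑ i, |q i| : ℝ) : ℂ)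
  refine (memℓp_gen_iff (by norm_num)).2 ?_
  refine Summable.of_nonneg_of_le (fun n => by positivity) (fun n => ?_)
    ((memℓp_gen_iff (by norm_num)).1 h)
  exact Real.rpow_le_rpow (norm_nonneg _) (norm_potential_mul_le q y n) (by norm_num)

/-- Multiplication `(Q y)_n = q_n y_n` by the potential on `ℓ²(ℤ)`. -/
noncomputable def mulPotential {k : ℕ} (q : Fin (2 * k) → ℝ) : Ell2 →L[ℂ] Ell2 :=
  LinearMap.mkContinuous
    { toFun := fun y => ⟨fun n => (periodicExt q n : ℂ) * y n, memlp_mul q y⟩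
      map_add' := fun y z => by ext n; simp [mul_add]; rfl
      map_smul' := fun c y => by ext n; simp [mul_left_comm] }
    (∑ i, |q i|) (fun y => by
      have hC : 0 ≤ ∑ i, |q i| := Finset.sum_nonneg fun i _ => abs_nonneg (q i)
      have h1 : ‖((∑ i, |q i| : ℝ) : ℂ) • y‖ = (∑ i, |q i|) * ‖y‖ := by
        rw [norm_smul, Complex.norm_real, Real.norm_of_nonneg hC]
      rw [← h1]
      exact lp.norm_mono (by norm_num) fun n => norm_potential_mul_le q y n)

/-- The Schrödinger operator `(L y)_n = y_{n-1} + y_{n+1} + q_n y_n` on `ℓ²(ℤ)`. -/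
noncomputable def schrodinger {k : ℕ} (q : Fin (2 * k) → ℝ) : Ell2 →L[ℂ] Ell2 :=
  shift (-1) + shift 1 + mulPotential q

theorem schrodinger_apply {k : ℕ} (q : Fin (2 * k) → ℝ) (y : Ell2) (n : ℤ) :
    schrodinger q y n = y (n - 1) + y (n + 1) + (periodicExt q n : ℂ) * y n := rfl

/-- The odd potentials isospectral to `q`. -/
def Iso {k : ℕ} (q : Fin (2 * k) → ℝ) : Set (Fin (2 * k) → ℝ) :=
  {p | p ∈ oddPotentials k ∧ spectrum ℂ (schrodinger q) = spectrum ℂ (schrodinger p)}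

/-! ### The Lyapunov function, gaps and heights -/

/-- The solution `y_n`, `n ≥ 0`, of `y_{n-1} + y_{n+1} + q_n y_n = λ y_n` with the initial
values `y_0 = a`, `y_1 = b`, as a polynomial in `λ`. -/
noncomputable def fundSol {k : ℕ} (q : Fin (2 * k) → ℝ) (a b : ℝ[X]) : ℕ → ℝ[X]
  | 0 => a
  | 1 => b
  | n + 2 => (X - C (periodicExt q ((n + 1 : ℕ) : ℤ))) * fundSol q a b (n + 1) - fundSol q a b n

/-- The Lyapunov function `Δ = φ_{2k+1} + ϑ_{2k}`, where `φ_0 = 0`, `φ_1 = 1` and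
`ϑ_0 = 1`, `ϑ_1 = 0`. -/
noncomputable def lyapunov {k : ℕ} (q : Fin (2 * k) → ℝ) : ℝ[X] :=
  fundSol q 0 1 (2 * k + 1) + fundSol q 1 0 (2 * k)

/-- The zeros of `Δ² - 4`, counted with multiplicity, in increasing order:
`λ_0^+ < λ_1^- ≤ λ_1^+ < ⋯ < λ_{2k-1}^- ≤ λ_{2k-1}^+ < λ_{2k}^-`. -/
noncomputable def bandEdges {k : ℕ} (q : Fin (2 * k) → ℝ) : List ℝ :=
  (lyapunov q ^ 2 - 4).roots.sort

/-- The left end `λ_n^-` of the `n`-th gap, `1 ≤ n ≤ 2k - 1`. -/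
noncomputable def gapLeft {k : ℕ} (q : Fin (2 * k) → ℝ) (n : ℕ) : ℝ :=
  (bandEdges q).getD (2 * n - 1) 0

/-- The right end `λ_n^+` of the `n`-th gap, `1 ≤ n ≤ 2k - 1`. -/
noncomputable def gapRight {k : ℕ} (q : Fin (2 * k) → ℝ) (n : ℕ) : ℝ :=
  (bandEdges q).getD (2 * n) 0

/-- The point `λ_n ∈ [λ_n^-, λ_n^+]` with `Δ'(λ_n) = 0`. -/
noncomputable def critPoint {k : ℕ} (q : Fin (2 * k) → ℝ) (n : ℕ) : ℝ :=
  Classical.epsilon fun x : ℝ =>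
    x ∈ Set.Icc (gapLeft q n) (gapRight q n) ∧ (derivative (lyapunov q)).eval x = 0

/-- The height `h_n ≥ 0` of the `n`-th slit, `Δ(λ_n) = 2 (-1)^{2k-n} cosh h_n`. -/
noncomputable def height {k : ℕ} (q : Fin (2 * k) → ℝ) (n : ℕ) : ℝ :=
  Real.arcosh ((-1) ^ (2 * k - n) * (lyapunov q).eval (critPoint q n) / 2)

/-- The height map `q ↦ (h_1(q), …, h_k(q))` on odd potentials, in the coordinates
`q_1, …, q_k`. -/
noncomputable def heightMap (k : ℕ) (x : Fin k → ℝ) : Fin k → ℝ :=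
  fun j => height (ofFirstHalf x) ((j : ℕ) + 1)

/-- The map `Φ` on odd potentials, in the coordinates `q_1, …, q_k`: its `j`-th component,
`1 ≤ j ≤ k`, is the coefficient of `λ^{2k-2j}` in `Δ`. -/
noncomputable def coeffMap (k : ℕ) (x : Fin k → ℝ) : Fin k → ℝ :=
  fun j => (lyapunov (ofFirstHalf x)).coeff (2 * k - 2 * ((j : ℕ) + 1))

/-- The surface `S` of odd potentials at which the Jacobian of `Φ` with respect to
`q_1, …, q_k` vanishes. -/
noncomputable def surface (k : ℕ) : Set (Fin (2 * k) → ℝ) :=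
  {q | q ∈ oddPotentials k ∧ (fderiv ℝ (coeffMap k) (firstHalf q)).det = 0}

end OddSchrodinger

open OddSchrodinger

open scoped Topology

namespace OddSchrodinger

/-! ### Fundamental solutions and the Lyapunov function -/

/-! Everything is read off the monic polynomial $\Delta$. Substituting the operator $L$ for
$\lambda$ gives $\Delta(L)=T^{2k}+T^{-2k}$ with $T$ the shift. Spectral mapping in one direction and
truncated Floquet solutions in the other give $\sigma(L)=\{z:\Delta(z)\in[-2,2]\}$
(`mem_spectrum_iff`). Since $L$ is self-adjoint, $\Delta-t$ has only real roots for $|t|\le 2$.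
Laguerre's inequality then gives $|\Delta|\ge 2$ and $\Delta''\ne 0$ at every critical point
(`IsDiscriminant.critical_value`). A Chebyshev alternation argument shows that the set
$\{|\Delta|\le 2\}$ determines $\Delta$, so isospectral means equal $\Delta$ (`spectrum_eq_iff`).

For odd $q$ the polynomial $\Delta$ is even, hence equivalent to $\Phi(q)$. At a critical point the
motion of $\lambda_n$ does not contribute to the derivative of $\Delta(\lambda_n)$. So where the
first $k$ gaps are open, $dh=D\,V\,d\Phi$ with $D$ an invertible diagonal matrix and $V$ a
Vandermonde matrix in the distinct numbers $\lambda_n^2$. If the $n$-th of these gaps is closed,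
both sides of (i) fail. The function $h_n\ge 0$ has a minimum there, so its derivative vanishes if
it exists. The Laguerre expression of $\Delta-\Delta(\lambda_n)$ at the fixed point $\lambda_n$ is
nonnegative for all potentials and zero at the given one; its vanishing derivative is a nontrivial
linear relation between the rows of $d\Phi$ (`valueDeriv_eq_zero`). This gives (i) and (ii).

For (iii), $\Delta$ is evaluated at the points $2\cos(m\pi/2k)$, $1\le m\le k$, which determine
$\Phi$. For the potential $sx$ the term linear in $s$ is a multiple of $\sum q_n=0$. What remains is
$s^2G(s,x)$, where $G_m(0,x)$ is a nonzero multiple of $\hat x_m^2$. If no $\hat x_m$ vanishes,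
$G(0,y)=G(0,x)$ has exactly the $2^k$ nondegenerate solutions $\hat y_m=\pm\hat x_m$. The norm of
$y$ is a function of $G(s,y)$, so solutions stay in a compact set, and the implicit function theorem
preserves their number for small $s$ (`eventually_ncard_zeros_eq`). -/

theorem periodicExt_add_period {k : ℕ} (q : Fin (2 * k) → ℝ) (n : ℤ) :
    periodicExt q (n + (2 * k : ℕ)) = periodicExt q n := by
  have h : (n + (2 * k : ℕ) - 1) % ((2 * k : ℕ) : ℤ) = (n - 1) % ((2 * k : ℕ) : ℤ) := by
    rw [show n + ((2 * k : ℕ) : ℤ) - 1 = n - 1 + ((2 * k : ℕ) : ℤ) by ring, Int.add_emod_right]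
  simp only [periodicExt, h]

theorem periodicExt_natCast_succ {k : ℕ} (q : Fin (2 * k) → ℝ) (i : Fin (2 * k)) :
    periodicExt q (((i : ℕ) + 1 : ℕ) : ℤ) = q i := by
  have h : ((((i : ℕ) + 1 : ℕ) : ℤ) - 1) % ((2 * k : ℕ) : ℤ) = ((i : ℕ) : ℤ) := by
    rw [show ((((i : ℕ) + 1 : ℕ) : ℤ) - 1) = ((i : ℕ) : ℤ) by push_cast; ring]
    exact Int.emod_eq_of_lt (by positivity) (by exact_mod_cast i.isLt)
  simp only [periodicExt, h, Int.toNat_natCast, i.isLt, dif_pos]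

theorem fundSol_add_two {k : ℕ} (q : Fin (2 * k) → ℝ) (a b : ℝ[X]) (n : ℕ) :
    fundSol q a b (n + 2) =
      (X - C (periodicExt q ((n + 1 : ℕ) : ℤ))) * fundSol q a b (n + 1) - fundSol q a b n := rfl

/-- The transfer matrices have determinant one, so the Wronskian keeps its initial value. -/
theorem wronskian_fundSol {k : ℕ} (q : Fin (2 * k) → ℝ) (n : ℕ) :
    fundSol q 0 1 (n + 1) * fundSol q 1 0 n - fundSol q 0 1 n * fundSol q 1 0 (n + 1) = 1 := by
  induction n with
  | zero => simp [fundSol]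
  | succ n ih => rw [fundSol_add_two, fundSol_add_two]; linear_combination ih

theorem natDegree_fundSol_le {k : ℕ} (q : Fin (2 * k) → ℝ) (a b : ℝ) (n : ℕ) :
    (fundSol q (C a) (C b) n).natDegree ≤ n - 1 ∧
      (fundSol q (C a) (C b) (n + 1)).natDegree ≤ n := by
  induction n with
  | zero => simp [fundSol]
  | succ n ih =>
    refine ⟨ih.2, ?_⟩
    rw [fundSol_add_two]
    refine (natDegree_sub_le _ _).trans (max_le (natDegree_mul_le.trans ?_) (ih.1.trans (by omega)))
    rw [natDegree_X_sub_C]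
    omega

theorem natDegree_fundSol_zero_one_succ_le {k : ℕ} (q : Fin (2 * k) → ℝ) (n : ℕ) :
    (fundSol q 0 1 (n + 1)).natDegree ≤ n := by
  simpa using (natDegree_fundSol_le q 0 1 n).2

theorem natDegree_fundSol_one_zero_add_two_le {k : ℕ} (q : Fin (2 * k) → ℝ) (n : ℕ) :
    (fundSol q 1 0 (n + 1)).natDegree ≤ n - 1 ∧ (fundSol q 1 0 (n + 2)).natDegree ≤ n := by
  induction n with
  | zero => simp [fundSol]
  | succ n ih =>
    refine ⟨ih.2, ?_⟩
    rw [fundSol_add_two]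
    refine (natDegree_sub_le _ _).trans (max_le (natDegree_mul_le.trans ?_) (ih.1.trans (by omega)))
    rw [natDegree_X_sub_C, add_comm]
    exact Nat.succ_le_succ ih.2

theorem coeff_X_sub_C_mul_succ (c : ℝ) (f : ℝ[X]) (n : ℕ) :
    ((X - C c) * f).coeff (n + 1) = f.coeff n - c * f.coeff (n + 1) := by
  rw [sub_mul, coeff_sub, coeff_X_mul, coeff_C_mul]

theorem coeff_fundSol_zero_one {k : ℕ} (q : Fin (2 * k) → ℝ) (n : ℕ) :
    (fundSol q 0 1 (n + 1)).coeff n = 1 := by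
  induction n with
  | zero => simp [fundSol]
  | succ n ih =>
    rw [fundSol_add_two, coeff_sub, coeff_X_sub_C_mul_succ, ih,
      coeff_eq_zero_of_natDegree_lt
        ((natDegree_fundSol_zero_one_succ_le q n).trans_lt (Nat.lt_succ_self n)),
      coeff_eq_zero_of_natDegree_lt (p := fundSol q 0 1 n)]
    · simp
    · have := (natDegree_fundSol_le q 0 1 n).1
      simp only [map_zero, map_one] at this
      omega

theorem coeff_fundSol_one_zero {k : ℕ} (q : Fin (2 * k) → ℝ) (n : ℕ) :
    (fundSol q 1 0 (n + 2)).coeff n = -1 := by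
  induction n with
  | zero => simp [fundSol]
  | succ n ih =>
    rw [fundSol_add_two, coeff_sub, coeff_X_sub_C_mul_succ, ih,
      coeff_eq_zero_of_natDegree_lt
        ((natDegree_fundSol_one_zero_add_two_le q n).2.trans_lt (Nat.lt_succ_self n)),
      coeff_eq_zero_of_natDegree_lt (p := fundSol q 1 0 (n + 1))]
    · simp
    · have := (natDegree_fundSol_one_zero_add_two_le q n).1
      omega

theorem coeff_fundSol_zero_one_second {k : ℕ} (q : Fin (2 * k) → ℝ) (n : ℕ) :
    (fundSol q 0 1 (n + 2)).coeff n = -∑ i ∈ Finset.range (n + 1), periodicExt q (i + 1 : ℕ) := by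
  induction n with
  | zero => simp [fundSol]
  | succ n ih =>
    rw [fundSol_add_two, coeff_sub, coeff_X_sub_C_mul_succ, ih, coeff_fundSol_zero_one,
      Finset.sum_range_succ _ (n + 1),
      coeff_eq_zero_of_natDegree_lt
        ((natDegree_fundSol_zero_one_succ_le q n).trans_lt (Nat.lt_succ_self n))]
    ring

/-- A continuant expansion: choosing two sites gives the second elementary symmetric function of the
$n+2$ values, and deleting one of the $n+1$ adjacent pairs gives $-1$ each. -/
theorem coeff_fundSol_zero_one_third {k : ℕ} (q : Fin (2 * k) → ℝ) (n : ℕ) :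
    (fundSol q 0 1 (n + 3)).coeff n =
      ((∑ i ∈ Finset.range (n + 2), periodicExt q (i + 1 : ℕ)) ^ 2 -
        ∑ i ∈ Finset.range (n + 2), periodicExt q (i + 1 : ℕ) ^ 2) / 2 - (n + 1) := by
  induction n with
  | zero =>
    simp [fundSol, Finset.sum_range_succ]
    ring
  | succ n ih =>
    rw [fundSol_add_two, coeff_sub, coeff_X_sub_C_mul_succ, ih, coeff_fundSol_zero_one_second,
      coeff_fundSol_zero_one, Finset.sum_range_succ _ (n + 2), Finset.sum_range_succ _ (n + 2)]
    push_cast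
    ring

theorem natDegree_lyapunov_le {k : ℕ} (q : Fin (2 * k) → ℝ) :
    (lyapunov q).natDegree ≤ 2 * k := by
  refine (natDegree_add_le _ _).trans (max_le (natDegree_fundSol_zero_one_succ_le q _) ?_)
  have := (natDegree_fundSol_le q 1 0 (2 * k)).1
  simp only [map_zero, map_one] at this
  omega

theorem coeff_lyapunov_top {k : ℕ} (hk : 1 ≤ k) (q : Fin (2 * k) → ℝ) :
    (lyapunov q).coeff (2 * k) = 1 := by
  obtain ⟨k, rfl⟩ := Nat.exists_eq_add_of_le hk
  rw [lyapunov, coeff_add, coeff_fundSol_zero_one, coeff_eq_zero_of_natDegree_lt, add_zero]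
  have := (natDegree_fundSol_one_zero_add_two_le q (2 * k)).2
  rw [show 2 * (1 + k) = 2 * k + 2 by ring]
  omega

theorem monic_lyapunov {k : ℕ} (hk : 1 ≤ k) (q : Fin (2 * k) → ℝ) : (lyapunov q).Monic :=
  monic_of_natDegree_le_of_coeff_eq_one _ (natDegree_lyapunov_le q) (coeff_lyapunov_top hk q)

theorem natDegree_lyapunov {k : ℕ} (hk : 1 ≤ k) (q : Fin (2 * k) → ℝ) :
    (lyapunov q).natDegree = 2 * k :=
  natDegree_eq_of_le_of_coeff_ne_zero (natDegree_lyapunov_le q)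
    (by rw [coeff_lyapunov_top hk]; exact one_ne_zero)

theorem sum_range_periodicExt {k : ℕ} (q : Fin (2 * k) → ℝ) (f : ℝ → ℝ) :
    ∑ i ∈ Finset.range (2 * k), f (periodicExt q (i + 1 : ℕ)) = ∑ i, f (q i) := by
  rw [Finset.sum_range]
  simp only [periodicExt_natCast_succ]

theorem sum_oddPotential {k : ℕ} {q : Fin (2 * k) → ℝ} (hq : q ∈ oddPotentials k) :
    ∑ i, q i = 0 := by
  have h : ∑ i, q i = -∑ i, q i := by
    rw [← Finset.sum_neg_distrib, ← Equiv.sum_comp Fin.revPerm q]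
    exact Finset.sum_congr rfl fun i _ => hq i
  linarith

/-- Since $\sum q_n=0$, the second symmetric function reduces to minus half the squared norm. Hence
$\Delta$ controls the norm of $q$, which later confines isospectral potentials to a compact set. -/
theorem coeff_lyapunov_second {k : ℕ} (hk : 1 ≤ k) {q : Fin (2 * k) → ℝ}
    (hq : q ∈ oddPotentials k) :
    (lyapunov q).coeff (2 * k - 2) = -(2 * k) - (∑ i, q i ^ 2) / 2 := by
  have h0 := sum_range_periodicExt q id
  have h1 := sum_range_periodicExt q (fun x => x ^ 2)
  simp only [id] at h0
  rw [sum_oddPotential hq] at h0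
  rw [← h1]
  obtain ⟨j, hj⟩ : ∃ j, 2 * k = j + 2 := ⟨2 * k - 2, by omega⟩
  rw [lyapunov, coeff_add]
  rw [hj] at h0
  have e1 : 2 * k - 2 = j := by omega
  have e2 : ((2 * k : ℕ) : ℝ) = j + 2 := by rw [hj]; push_cast; ring
  push_cast at e2
  rw [e1, hj, coeff_fundSol_zero_one_third, coeff_fundSol_one_zero, h0, e2]
  ring

/-! ### Transfer matrices and the evenness of the Lyapunov function -/

/-- The transfer matrix at a site where the potential has the value `v`. -/
noncomputable def transferMatrix (v : ℝ) : Matrix (Fin 2) (Fin 2) ℝ[X] := !![X - C v, -1; 1, 0]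

/-- The product of the first `n` transfer matrices along the sequence `v`. -/
noncomputable def monodromy (v : ℕ → ℝ) : ℕ → Matrix (Fin 2) (Fin 2) ℝ[X]
  | 0 => 1
  | n + 1 => transferMatrix (v n) * monodromy v n

theorem monodromy_eq_fundSol {k : ℕ} (q : Fin (2 * k) → ℝ) (n : ℕ) :
    monodromy (fun i => periodicExt q (i + 1 : ℕ)) n =
      !![fundSol q 0 1 (n + 1), fundSol q 1 0 (n + 1); fundSol q 0 1 n, fundSol q 1 0 n] := by
  induction n with
  | zero => simp [monodromy, fundSol, Matrix.one_fin_two]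
  | succ n ih =>
    rw [monodromy, ih, transferMatrix, fundSol_add_two, fundSol_add_two]
    simp [sub_eq_add_neg]

theorem lyapunov_eq_trace {k : ℕ} (q : Fin (2 * k) → ℝ) :
    lyapunov q = (monodromy (fun i => periodicExt q (i + 1 : ℕ)) (2 * k)).trace := by
  rw [monodromy_eq_fundSol, Matrix.trace_fin_two_of, lyapunov]

theorem monodromy_succ' (v : ℕ → ℝ) (n : ℕ) :
    monodromy v (n + 1) = monodromy (fun i => v (i + 1)) n * transferMatrix (v 0) := by
  induction n with
  | zero => simp [monodromy]
  | succ n ih => rw [monodromy, ih, monodromy, mul_assoc]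

theorem monodromy_congr {v w : ℕ → ℝ} {n : ℕ} (h : ∀ i < n, v i = w i) :
    monodromy v n = monodromy w n := by
  induction n with
  | zero => rfl
  | succ n ih =>
    rw [monodromy, monodromy, h n n.lt_succ_self, ih fun i hi => h i (hi.trans n.lt_succ_self)]

/-- The reflection conjugating a transfer matrix to its transpose. -/
noncomputable def signMatrix : Matrix (Fin 2) (Fin 2) ℝ[X] := !![1, 0; 0, -1]

theorem signMatrix_mul_self : signMatrix * signMatrix = 1 := by
  simp [signMatrix, Matrix.one_fin_two]

theorem transpose_transferMatrix (v : ℝ) :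
    (transferMatrix v).transpose = signMatrix * transferMatrix v * signMatrix := by
  ext i j
  fin_cases i <;> fin_cases j <;> simp [transferMatrix, signMatrix]

/-- Transposition reverses the product, and each factor is conjugate to its transpose by the same
reflection; inner reflections cancel. -/
theorem transpose_monodromy (v : ℕ → ℝ) (n : ℕ) :
    (monodromy v n).transpose =
      signMatrix * monodromy (fun i => v (n - 1 - i)) n * signMatrix := by
  induction n with
  | zero => simp [monodromy, signMatrix_mul_self]
  | succ n ih =>
    rw [monodromy, Matrix.transpose_mul, ih, transpose_transferMatrix, monodromy_succ']
    rw [monodromy_congr (v := fun i => v (n + 1 - 1 - (i + 1))) (w := fun i => v (n - 1 - i))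
      fun i _ => by congr 1; omega]
    simp only [mul_assoc, Nat.add_sub_cancel, Nat.sub_zero]
    rw [← mul_assoc signMatrix signMatrix, signMatrix_mul_self, one_mul]

theorem map_comp_neg_monodromy (v : ℕ → ℝ) (n : ℕ) :
    (monodromy (fun i => -v i) n).map (fun f => f.comp (-X)) =
      (-1 : ℝ[X]) ^ n • (signMatrix * monodromy v n * signMatrix) := by
  have hmap : ∀ A : Matrix (Fin 2) (Fin 2) ℝ[X],
      A.map (fun f => f.comp (-X)) = (compRingHom (-X : ℝ[X])).mapMatrix A := fun A => rfl
  induction n with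
  | zero => rw [hmap, monodromy, map_one, monodromy, mul_one, signMatrix_mul_self, pow_zero, one_smul]
  | succ n ih =>
    rw [hmap] at ih ⊢
    have h : (compRingHom (-X : ℝ[X])).mapMatrix (transferMatrix (-v n)) =
        (-1 : ℝ[X]) • (signMatrix * transferMatrix (v n) * signMatrix) := by
      ext i j
      fin_cases i <;> fin_cases j <;> simp [transferMatrix, signMatrix, sub_eq_add_neg, -neg_mul]
      simp
      ring
    rw [monodromy, map_mul, ih, h, monodromy, smul_mul_smul_comm, pow_succ']
    simp only [mul_assoc]
    rw [← mul_assoc signMatrix signMatrix, signMatrix_mul_self, one_mul]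

theorem trace_sign_conj (A : Matrix (Fin 2) (Fin 2) ℝ[X]) :
    (signMatrix * A * signMatrix).trace = A.trace := by
  rw [Matrix.trace_mul_comm, ← mul_assoc, signMatrix_mul_self, one_mul]

/-- For odd $q$, reading the sites backwards changes the sign of the potential. The trace does not
see the reversal, by transposition; replacing $(\lambda,q)$ by $(-\lambda,-q)$ turns each transfer
matrix into minus its reflected conjugate, and $(-1)^{2k}=1$. -/
theorem lyapunov_comp_neg {k : ℕ} {q : Fin (2 * k) → ℝ} (hq : q ∈ oddPotentials k) :
    (lyapunov q).comp (-X) = lyapunov q := by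
  set v : ℕ → ℝ := fun i => periodicExt q (i + 1 : ℕ) with hv
  have hrev : monodromy (fun i => v (2 * k - 1 - i)) (2 * k) =
      monodromy (fun i => -v i) (2 * k) := by
    refine monodromy_congr fun i hi => ?_
    have h1 := periodicExt_natCast_succ q ⟨i, hi⟩
    have h2 := periodicExt_natCast_succ q (Fin.rev ⟨i, hi⟩)
    simp only [hv]
    rw [h1, ← hq ⟨i, hi⟩, ← h2]
    congr 3
    simp only [Fin.val_rev]
    omega
  have h1 : (monodromy v (2 * k)).trace = (monodromy (fun i => -v i) (2 * k)).trace := by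
    rw [← Matrix.trace_transpose, transpose_monodromy, hrev, trace_sign_conj]
  have h2 := congrArg Matrix.trace (map_comp_neg_monodromy v (2 * k))
  rw [Matrix.trace_smul, trace_sign_conj, Even.neg_one_pow (even_two_mul k), one_smul] at h2
  have h3 : lyapunov q = (monodromy v (2 * k)).trace := lyapunov_eq_trace q
  rw [h3]
  conv_lhs => rw [h1]
  rw [← h2]
  simp [Matrix.trace_fin_two]

theorem coeff_lyapunov_odd {k : ℕ} {q : Fin (2 * k) → ℝ} (hq : q ∈ oddPotentials k) {n : ℕ}
    (hn : Odd n) : (lyapunov q).coeff n = 0 := by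
  have h := congrArg (fun f => f.coeff n) (lyapunov_comp_neg hq)
  have h2 : ((lyapunov q).comp (-X)).coeff n = (-1) ^ n * (lyapunov q).coeff n := by
    rw [← neg_one_mul, ← C_1, ← C_neg, comp_C_mul_X_coeff, mul_comm]
  simp only [h2, hn.neg_one_pow] at h
  linarith

/-! ### Even monic polynomials and the coefficient map -/

/-- The even monic polynomial `λ^{2k} + ∑ a_j λ^{2(k-1-j)}`. -/
noncomputable def evenPoly {k : ℕ} (a : Fin k → ℝ) : ℝ[X] :=
  X ^ (2 * k) + ∑ j : Fin k, C (a j) * X ^ (2 * (k - 1 - (j : ℕ)))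

theorem sum_range_two_mul {M : Type*} [AddCommMonoid M] (f : ℕ → M) (n : ℕ) :
    ∑ i ∈ Finset.range (2 * n), f i = ∑ i ∈ Finset.range n, (f (2 * i) + f (2 * i + 1)) := by
  induction n with
  | zero => simp
  | succ n ih =>
    rw [show 2 * (n + 1) = 2 * n + 1 + 1 by ring, Finset.sum_range_succ, Finset.sum_range_succ, ih,
      Finset.sum_range_succ, add_assoc]

theorem lyapunov_ofFirstHalf {k : ℕ} (hk : 1 ≤ k) (x : Fin k → ℝ) :
    lyapunov (ofFirstHalf x) = evenPoly (coeffMap k x) := by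
  have h := as_sum_range_C_mul_X_pow (lyapunov (ofFirstHalf x))
  rw [natDegree_lyapunov hk, Finset.sum_range_succ, coeff_lyapunov_top hk, sum_range_two_mul] at h
  rw [h, evenPoly, C_1, one_mul, add_comm, ← Finset.sum_range_reflect, Finset.sum_range]
  congr 1
  refine Finset.sum_congr rfl fun j _ => ?_
  rw [coeff_lyapunov_odd (ofFirstHalf_mem x) (odd_two_mul_add_one _), coeffMap]
  simp only [map_zero, zero_mul, add_zero]
  congr 3
  omega

theorem eval_evenPoly {k : ℕ} (a : Fin k → ℝ) (t : ℝ) :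
    (evenPoly a).eval t = t ^ (2 * k) + ∑ j : Fin k, a j * t ^ (2 * (k - 1 - (j : ℕ))) := by
  simp [evenPoly, eval_finsetSum]

theorem contDiff_periodicExt_ofFirstHalf {k : ℕ} {N : WithTop ℕ∞} (n : ℤ) :
    ContDiff ℝ N fun x : Fin k → ℝ => periodicExt (ofFirstHalf x) n := by
  unfold periodicExt ofFirstHalf
  split_ifs
  · exact contDiff_apply _ _ _
  · exact (contDiff_apply _ _ _).neg
  · exact contDiff_const

theorem contDiff_coeff_fundSol {k : ℕ} {N : WithTop ℕ∞} (a b : ℝ[X]) (n : ℕ) :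
    (∀ i, ContDiff ℝ N fun x : Fin k → ℝ => (fundSol (ofFirstHalf x) a b n).coeff i) ∧
      ∀ i, ContDiff ℝ N fun x : Fin k → ℝ => (fundSol (ofFirstHalf x) a b (n + 1)).coeff i := by
  induction n with
  | zero => exact ⟨fun i => contDiff_const, fun i => contDiff_const⟩
  | succ n ih =>
    refine ⟨ih.2, fun i => ?_⟩
    simp only [fundSol_add_two, coeff_sub, sub_mul, coeff_C_mul]
    refine (ContDiff.sub ?_ ((contDiff_periodicExt_ofFirstHalf _).mul (ih.2 i))).sub (ih.1 i)
    cases i with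
    | zero => simpa using contDiff_const
    | succ i => simpa only [coeff_X_mul] using ih.2 i

theorem contDiff_coeffMap {k : ℕ} {N : WithTop ℕ∞} : ContDiff ℝ N (coeffMap k) := by
  refine contDiff_pi.2 fun j => ?_
  simp only [coeffMap, lyapunov, coeff_add]
  exact ((contDiff_coeff_fundSol _ _ _).1 _).add ((contDiff_coeff_fundSol _ _ _).1 _)

/-- The matrix with the entries `t_i^{2(k-1-j)}`, which sends the coefficients of an even
polynomial to its values at the nodes `t_i`. -/
def nodeMatrix {k : ℕ} (t : Fin k → ℝ) : Matrix (Fin k) (Fin k) ℝ :=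
  Matrix.of fun i j => t i ^ (2 * (k - 1 - (j : ℕ)))

/-- This is the Vandermonde matrix of the squares $t_i^2$ with its columns in reverse order. -/
theorem det_nodeMatrix_ne_zero {k : ℕ} {t : Fin k → ℝ}
    (ht : Function.Injective fun i => t i ^ 2) : (nodeMatrix t).det ≠ 0 := by
  have h : nodeMatrix t = (Matrix.vandermonde fun i => t i ^ 2).submatrix id Fin.revPerm := by
    ext i j
    simp only [nodeMatrix, Matrix.of_apply, Matrix.submatrix_apply, Matrix.vandermonde_apply, id,
      Fin.revPerm_apply, Fin.val_rev, ← pow_mul]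
    congr 2
    omega
  rw [h, Matrix.det_permute']
  exact mul_ne_zero (by simp) (Matrix.det_vandermonde_ne_zero_iff.2 ht)

/-- Evaluation of the lower order part of an even polynomial at given nodes. -/
noncomputable def nodeEval {k : ℕ} (t : Fin k → ℝ) : (Fin k → ℝ) →L[ℝ] (Fin k → ℝ) :=
  LinearMap.toContinuousLinearMap (Matrix.toLin' (nodeMatrix t))

theorem nodeEval_apply {k : ℕ} (t a : Fin k → ℝ) (i : Fin k) :
    nodeEval t a i = ∑ j : Fin k, a j * t i ^ (2 * (k - 1 - (j : ℕ))) := by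
  simp [nodeEval, nodeMatrix, Matrix.mulVec, dotProduct, mul_comm]

theorem eval_evenPoly_eq_nodeEval {k : ℕ} (t a : Fin k → ℝ) (i : Fin k) :
    (evenPoly a).eval (t i) = t i ^ (2 * k) + nodeEval t a i := by
  rw [eval_evenPoly, nodeEval_apply]

theorem det_nodeEval_ne_zero {k : ℕ} {t : Fin k → ℝ}
    (ht : Function.Injective fun i => t i ^ 2) : (nodeEval t).det ≠ 0 := by
  rw [nodeEval, LinearMap.det_toContinuousLinearMap, LinearMap.det_toLin']
  exact det_nodeMatrix_ne_zero ht

theorem injective_of_det_ne_zero {k : ℕ} {f : (Fin k → ℝ) →L[ℝ] (Fin k → ℝ)} (hf : f.det ≠ 0) :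
    Function.Injective f := by
  have := (LinearMap.equivOfDetNeZero (f : (Fin k → ℝ) →ₗ[ℝ] (Fin k → ℝ)) hf).injective
  exact this

theorem det_eq_zero_of_forall_apply_eq_zero {k : ℕ} {f : (Fin k → ℝ) →L[ℝ] (Fin k → ℝ)}
    (i : Fin k) (h : ∀ v, f v i = 0) : f.det = 0 := by
  by_contra hf
  have hs : Function.Surjective f :=
    (LinearMap.equivOfDetNeZero (f : (Fin k → ℝ) →ₗ[ℝ] (Fin k → ℝ)) hf).surjective
  obtain ⟨v, hv⟩ := hs (Pi.single i 1)
  have := h v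
  rw [hv] at this
  simp at this

theorem det_comp {k : ℕ} (f g : (Fin k → ℝ) →L[ℝ] (Fin k → ℝ)) :
    (f.comp g).det = f.det * g.det :=
  LinearMap.det_comp _ _

/-! ### Real polynomials with the critical values outside `(-2, 2)` -/

/-- The induction step for Laguerre's inequality: a further real root turns $g'^2-gg''$ into a
square plus a nonnegative multiple of itself. -/
theorem laguerre_X_sub_C_mul (g : ℝ[X]) (r x : ℝ) :
    (derivative ((X - C r) * g)).eval x ^ 2 -
        ((X - C r) * g).eval x * (derivative (derivative ((X - C r) * g))).eval x =
      g.eval x ^ 2 + (x - r) ^ 2 *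
        ((derivative g).eval x ^ 2 - g.eval x * (derivative (derivative g)).eval x) := by
  simp only [derivative_mul, derivative_sub, derivative_X, derivative_C, derivative_add, eval_add,
    eval_mul, eval_sub, eval_X, eval_C, sub_zero, one_mul]
  ring

theorem laguerre_nonneg {f : ℝ[X]} (hf : f.Splits) (x : ℝ) :
    0 ≤ (derivative f).eval x ^ 2 - f.eval x * (derivative (derivative f)).eval x := by
  rw [hf.eq_prod_roots]
  induction f.roots using Multiset.induction_on with
  | empty => simp
  | cons r s ih =>
    rw [Multiset.map_cons, Multiset.prod_cons, mul_left_comm, laguerre_X_sub_C_mul]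
    positivity

theorem laguerre_pos {f : ℝ[X]} (hf : f.Splits) (hd : 0 < f.natDegree) {x : ℝ}
    (hx : f.eval x ≠ 0) :
    0 < (derivative f).eval x ^ 2 - f.eval x * (derivative (derivative f)).eval x := by
  have hne : f.roots ≠ 0 := by
    intro h
    rw [hf.natDegree_eq_card_roots, h] at hd
    simp at hd
  obtain ⟨r, hr⟩ := Multiset.exists_mem_of_ne_zero hne
  have hf0 : f ≠ 0 := by rintro rfl; simp at hd
  obtain ⟨g, rfl⟩ := dvd_iff_isRoot.2 (isRoot_of_mem_roots hr)
  have hg : g.Splits := ((splits_mul (left_ne_zero_of_mul hf0) (right_ne_zero_of_mul hf0)).1 hf).2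
  rw [laguerre_X_sub_C_mul]
  have h1 : g.eval x ≠ 0 := by
    rw [eval_mul] at hx
    exact right_ne_zero_of_mul hx
  have h2 := laguerre_nonneg hg x
  positivity

/-- Monic polynomials of even degree `m` all of whose values `±2` are taken at real points. -/
structure IsDiscriminant (P : ℝ[X]) (m : ℕ) : Prop where
  monic : P.Monic
  natDegree_eq : P.natDegree = m
  even : Even m
  pos : 0 < m
  splits_sub : (P - C 2).Splits
  splits_add : (P + C 2).Splits

namespace IsDiscriminant

variable {P : ℝ[X]} {m : ℕ}

/-- With $P'(x)=0$, Laguerre's inequality for $P\mp 2$ says that $(P(x)\mp 2)P''(x)<0$ wherever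
$P(x)\ne\pm 2$. Both factors $P(x)\mp 2$ must then have the sign opposite to $P''(x)$, which
excludes $|P(x)|<2$; at $P(x)=\pm 2$ one of the two inequalities is still available. -/
theorem critical_value (hP : IsDiscriminant P m) {x : ℝ} (hx : (derivative P).eval x = 0) :
    (2 ≤ P.eval x ∧ (derivative (derivative P)).eval x < 0) ∨
      (P.eval x ≤ -2 ∧ 0 < (derivative (derivative P)).eval x) := by
  have h1 : P.eval x ≠ 2 → (P.eval x - 2) * (derivative (derivative P)).eval x < 0 := by
    intro h
    have := laguerre_pos hP.splits_sub (by rw [natDegree_sub_C, hP.natDegree_eq]; exact hP.pos)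
      (x := x) (by simpa [sub_eq_zero] using h)
    simp only [derivative_sub, derivative_C, sub_zero, hx, eval_sub, eval_C] at this
    linarith
  have h2 : P.eval x ≠ -2 → (P.eval x + 2) * (derivative (derivative P)).eval x < 0 := by
    intro h
    have := laguerre_pos hP.splits_add (by rw [natDegree_add_C, hP.natDegree_eq]; exact hP.pos)
      (x := x) (by simpa [← eq_neg_iff_add_eq_zero] using h)
    simp only [derivative_add, derivative_C, add_zero, hx, eval_add, eval_C] at this
    linarith
  set p := P.eval x
  set d := (derivative (derivative P)).eval x
  by_cases e1 : p = 2
  · have := h2 (by rw [e1]; norm_num)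
    left
    rw [e1] at this ⊢
    exact ⟨le_rfl, by linarith⟩
  by_cases e2 : p = -2
  · have := h1 (by rw [e2]; norm_num)
    right
    rw [e2] at this ⊢
    exact ⟨le_rfl, by linarith⟩
  have i1 := h1 e1
  have i2 := h2 e2
  rcases lt_trichotomy d 0 with hd | hd | hd
  · left
    exact ⟨by nlinarith, hd⟩
  · rw [hd] at i1
    simp at i1
  · right
    exact ⟨by nlinarith, hd⟩

theorem natDegree_derivative (hP : IsDiscriminant P m) : (derivative P).natDegree = m - 1 := by
  rw [Polynomial.natDegree_derivative, hP.natDegree_eq]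

theorem derivative_ne_zero (hP : IsDiscriminant P m) : derivative P ≠ 0 := by
  intro h
  have := derivative_eq_zero.1 h
  have := hP.pos
  have := hP.natDegree_eq
  omega

theorem nodup_roots_derivative (hP : IsDiscriminant P m) : (derivative P).roots.Nodup := by
  rw [Multiset.nodup_iff_count_le_one]
  intro x
  rw [count_roots]
  by_contra! h
  have h2 := (one_lt_rootMultiplicity_iff_isRoot hP.derivative_ne_zero).1 h
  rcases hP.critical_value h2.1 with h3 | h3
  · exact h3.2.ne h2.2
  · exact h3.2.ne' h2.2

/-- Rolle's theorem applied to $P-2$, whose $m$ roots are real, leaves $m-1$ real roots of $P'$ with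
multiplicity; they are simple because $P''$ does not vanish at them. -/
theorem exists_critical_points (hP : IsDiscriminant P m) :
    ∃ d : Fin (m - 1) → ℝ, StrictMono d ∧ ∀ i, (derivative P).eval (d i) = 0 := by
  have h1 : (derivative P).roots.card = m - 1 := by
    refine le_antisymm ((card_roots' _).trans hP.natDegree_derivative.le) ?_
    have h := card_roots_le_derivative (P - C 2)
    rw [← hP.splits_sub.natDegree_eq_card_roots, natDegree_sub_C, hP.natDegree_eq, derivative_sub,
      derivative_C, sub_zero] at h
    omega
  have h2 : (derivative P).roots.toFinset.card = m - 1 := by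
    rw [Multiset.toFinset_card_of_nodup hP.nodup_roots_derivative, h1]
  refine ⟨(derivative P).roots.toFinset.orderEmbOfFin h2, OrderEmbedding.strictMono _, fun i => ?_⟩
  have := Finset.orderEmbOfFin_mem _ h2 i
  rw [Multiset.mem_toFinset] at this
  exact isRoot_of_mem_roots this

theorem derivative_eq_nodal (hP : IsDiscriminant P m) {d : Fin (m - 1) → ℝ} (hd : StrictMono d)
    (hd0 : ∀ i, (derivative P).eval (d i) = 0) :
    derivative P = C (m : ℝ) * Lagrange.nodal Finset.univ d := by
  have hm : (m : ℝ) ≠ 0 := by exact_mod_cast hP.pos.ne'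
  have hdeg : (derivative P).degree = ((m - 1 : ℕ) : WithBot ℕ) := by
    rw [degree_eq_natDegree hP.derivative_ne_zero, hP.natDegree_derivative]
  have hdeg2 : (C (m : ℝ) * Lagrange.nodal Finset.univ d).degree = ((m - 1 : ℕ) : WithBot ℕ) := by
    rw [degree_C_mul hm, Lagrange.degree_nodal, Finset.card_univ, Fintype.card_fin]
  refine eq_of_degree_sub_lt_of_eval_index_eq (s := Finset.univ) (v := d) hd.injective.injOn ?_ ?_
  · rw [Finset.card_univ, Fintype.card_fin, ← hdeg]
    refine degree_sub_lt_left (hdeg.trans hdeg2.symm) hP.derivative_ne_zero ?_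
    rw [leadingCoeff_mul, leadingCoeff_C, Lagrange.nodal_monic.leadingCoeff, leadingCoeff,
      hP.natDegree_derivative, coeff_derivative]
    have h1 : P.coeff (m - 1 + 1) = 1 := by
      rw [Nat.sub_add_cancel hP.pos, ← hP.natDegree_eq]
      exact hP.monic
    have h2 : ((m - 1 : ℕ) : ℝ) + 1 = m := by exact_mod_cast Nat.sub_add_cancel hP.pos
    rw [h1, h2]
    ring
  · intro i _
    rw [hd0, eval_mul, Lagrange.eval_nodal_at_node (Finset.mem_univ i), mul_zero]

theorem derivative_eval_eq_zero_iff (hP : IsDiscriminant P m) {d : Fin (m - 1) → ℝ}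
    (hd : StrictMono d) (hd0 : ∀ i, (derivative P).eval (d i) = 0) (x : ℝ) :
    (derivative P).eval x = 0 ↔ ∃ i, x = d i := by
  refine ⟨fun h => ?_, fun ⟨i, hi⟩ => hi ▸ hd0 i⟩
  rw [hP.derivative_eq_nodal hd hd0, eval_mul, eval_C, Lagrange.eval_nodal] at h
  have hm : (m : ℝ) ≠ 0 := by exact_mod_cast hP.pos.ne'
  obtain ⟨i, -, hi⟩ := Finset.prod_eq_zero_iff.1 ((mul_eq_zero_iff_left hm).1 h)
  exact ⟨i, sub_eq_zero.1 hi⟩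

end IsDiscriminant

/-- Exactly the $n-1-i$ factors with $j>i$ are negative. -/
theorem neg_one_pow_mul_prod_sub_pos {n : ℕ} {x : Fin n → ℝ} (hx : StrictMono x) (i : Fin n) :
    0 < (-1 : ℝ) ^ (n - 1 - i) * ∏ j ∈ Finset.univ.erase i, (x i - x j) := by
  have h : Finset.univ.erase i = Finset.Iio i ∪ Finset.Ioi i := by
    ext j
    simp [lt_or_lt_iff_ne]
  have hdis : Disjoint (Finset.Iio i) (Finset.Ioi i) := by
    rw [Finset.disjoint_left]
    intro j h1 h2
    rw [Finset.mem_Iio] at h1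
    rw [Finset.mem_Ioi] at h2
    exact lt_asymm h1 h2
  rw [h, Finset.prod_union hdis, ← Fin.card_Ioi, ← Finset.prod_const, mul_left_comm,
    ← Finset.prod_mul_distrib]
  refine mul_pos (Finset.prod_pos fun j hj => ?_) (Finset.prod_pos fun j hj => ?_)
  · exact sub_pos.2 (hx (Finset.mem_Iio.1 hj))
  · have := hx (Finset.mem_Ioi.1 hj)
    linarith

namespace IsDiscriminant

variable {P : ℝ[X]} {m : ℕ}

/-- The factorization of $P'$ gives the sign of $P''(d_i)$, and `critical_value` converts it into
the opposite sign for $P(d_i)$. -/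
theorem critical_value_sign (hP : IsDiscriminant P m) {d : Fin (m - 1) → ℝ}
    (hd : StrictMono d) (hd0 : ∀ i, (derivative P).eval (d i) = 0) (i : Fin (m - 1)) :
    2 ≤ (-1 : ℝ) ^ (m - 1 - i) * P.eval (d i) := by
  have hm : (0 : ℝ) < m := by exact_mod_cast hP.pos
  have h1 := neg_one_pow_mul_prod_sub_pos hd i
  have h2 : (derivative (derivative P)).eval (d i) =
      m * ∏ j ∈ Finset.univ.erase i, (d i - d j) := by
    conv_lhs => rw [hP.derivative_eq_nodal hd hd0]
    rw [derivative_C_mul, eval_C_mul,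
      Lagrange.eval_nodal_derivative_eval_node_eq (Finset.mem_univ i), Lagrange.eval_nodal]
  have h3 : 0 < (-1 : ℝ) ^ (m - 1 - 1 - i) * (derivative (derivative P)).eval (d i) := by
    rw [h2, mul_left_comm]
    positivity
  have hi := i.isLt
  rw [show m - 1 - (i : ℕ) = m - 1 - 1 - i + 1 by omega, pow_succ]
  rcases neg_one_pow_eq_or ℝ (m - 1 - 1 - i) with h | h <;> rw [h] at h3 ⊢ <;>
    rcases hP.critical_value (hd0 i) with h4 | h4 <;> linarith [h4.1, h4.2]

theorem tendsto_atTop (hP : IsDiscriminant P m) :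
    Filter.Tendsto (fun x => P.eval x) Filter.atTop Filter.atTop :=
  Polynomial.tendsto_atTop_of_leadingCoeff_nonneg P
    (natDegree_pos_iff_degree_pos.1 (hP.natDegree_eq ▸ hP.pos)) (by rw [hP.monic]; exact zero_le_one)

theorem tendsto_atBot (hP : IsDiscriminant P m) :
    Filter.Tendsto (fun x => P.eval x) Filter.atBot Filter.atTop := by
  have hd : (P.comp (-X)).natDegree = m := by
    rw [natDegree_comp, natDegree_neg, natDegree_X, mul_one, hP.natDegree_eq]
  have h : Filter.Tendsto (fun x => (P.comp (-X)).eval x) Filter.atTop Filter.atTop := by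
    refine Polynomial.tendsto_atTop_of_leadingCoeff_nonneg _
      (natDegree_pos_iff_degree_pos.1 (hd ▸ hP.pos)) ?_
    rw [leadingCoeff_comp (by simp), hP.monic, leadingCoeff_neg, leadingCoeff_X, hP.natDegree_eq,
      hP.even.neg_one_pow]
    norm_num
  have := h.comp Filter.tendsto_neg_atBot_atTop
  refine this.congr fun x => ?_
  simp

/-- The critical points together with a point on either side of them. -/
theorem exists_alternation (hP : IsDiscriminant P m) {d : Fin (m - 1) → ℝ}
    (hd : StrictMono d) (hd0 : ∀ i, (derivative P).eval (d i) = 0) :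
    ∃ c : ℕ → ℝ, (∀ n < m, c n < c (n + 1)) ∧ (∀ n ≤ m, 2 ≤ (-1 : ℝ) ^ (m - n) * P.eval (c n)) ∧
      ∀ i : Fin (m - 1), c (i + 1) = d i := by
  have hm := hP.pos
  have hm2 : 2 ≤ m := by
    obtain ⟨j, hj⟩ := hP.even
    omega
  obtain ⟨a, ha2, ha⟩ := ((hP.tendsto_atBot.eventually_ge_atTop 2).and
    (Filter.eventually_lt_atBot (d ⟨0, by omega⟩))).exists
  obtain ⟨b, hb2, hb⟩ := ((hP.tendsto_atTop.eventually_ge_atTop 2).and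
    (Filter.eventually_gt_atTop (d ⟨m - 2, by omega⟩))).exists
  -- Indices $0$ and $m$ carry the outer points, where $P\ge 2$ because $m$ is even; the critical
  -- points occupy $1,\dots,m-1$.
  refine ⟨fun n => if n = 0 then a else if h : n - 1 < m - 1 then d ⟨n - 1, h⟩ else b,
    fun n hn => ?_, fun n hn => ?_, fun i => by simp⟩
  · rcases Nat.eq_zero_or_pos n with rfl | h0
    · simpa [show 0 < m - 1 by omega] using ha
    · have h1 : n - 1 < m - 1 := by omega
      simp only [h0.ne', if_false, h1, dif_pos, Nat.succ_ne_zero, Nat.add_sub_cancel]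
      split_ifs with h2
      · exact hd (by rw [Fin.mk_lt_mk]; omega)
      · refine lt_of_le_of_lt (hd.monotone ?_) hb
        rw [Fin.mk_le_mk]
        omega
  · rcases Nat.eq_zero_or_pos n with rfl | h0
    · simpa [hP.even.neg_one_pow] using ha2
    · simp only [h0.ne', if_false]
      split_ifs with h2
      · have := hP.critical_value_sign hd hd0 ⟨n - 1, h2⟩
        rwa [show m - 1 - (n - 1) = m - n by omega] at this
      · rw [show m - n = 0 by omega]
        simpa using hb2

end IsDiscriminant

/-- The points of value `±2` between consecutive points of an alternation. -/
theorem exists_crossings {P : ℝ[X]} {m : ℕ} {c : ℕ → ℝ} (hc : ∀ n < m, c n < c (n + 1))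
    (hc2 : ∀ n ≤ m, 2 ≤ (-1 : ℝ) ^ (m - n) * P.eval (c n)) :
    ∃ u v : ℕ → ℝ, ∀ n < m, c n ≤ u n ∧ u n < v n ∧ v n ≤ c (n + 1) ∧
      P.eval (u n) = 2 * (-1) ^ (m - n) ∧ P.eval (v n) = -(2 * (-1) ^ (m - n)) := by
  have key : ∀ n, ∃ u v : ℝ, n < m → c n ≤ u ∧ u < v ∧ v ≤ c (n + 1) ∧
      P.eval u = 2 * (-1) ^ (m - n) ∧ P.eval v = -(2 * (-1) ^ (m - n)) := by
    intro n
    by_cases hn : n < m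
    swap
    · exact ⟨0, 0, fun h => absurd h hn⟩
    set s : ℝ := (-1) ^ (m - n) with hs
    have hs2 : s * s = 1 := by rw [hs, ← mul_pow]; norm_num
    have hs1 : (-1 : ℝ) ^ (m - (n + 1)) = -s := by
      rw [hs, show m - n = m - (n + 1) + 1 by omega, pow_succ]
      ring
    have h0 := hc2 n hn.le
    have h1 := hc2 (n + 1) hn
    rw [hs1] at h1
    have hcont : Continuous fun x => s * P.eval x := by fun_prop
    obtain ⟨u, hu, hu2⟩ := intermediate_value_Icc' (hc n hn).le hcont.continuousOn
      (show (2 : ℝ) ∈ _ from ⟨by linarith, h0⟩)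
    obtain ⟨v, hv, hv2⟩ := intermediate_value_Icc' hu.2 hcont.continuousOn
      (show (-2 : ℝ) ∈ _ from ⟨by linarith, hu2.ge.trans' (by norm_num)⟩)
    simp only at hu2 hv2
    refine ⟨u, v, fun _ => ⟨hu.1, lt_of_le_of_ne hv.1 ?_, hv.2, ?_, ?_⟩⟩
    · rintro rfl
      linarith
    · linear_combination s * hu2 - P.eval u * hs2
    · linear_combination s * hv2 - P.eval v * hs2
  choose u v huv using key
  exact ⟨u, v, fun n hn => huv n hn⟩

/-! ### Band edges -/

theorem strictMono_nat_of_lt_succ_of_lt {m : ℕ} {u : ℕ → ℝ} (h : ∀ n, n + 1 < m → u n < u (n + 1))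
    {i j : ℕ} (hij : i < j) (hj : j < m) : u i < u j := by
  induction j, hij using Nat.le_induction with
  | base => exact h i hj
  | succ j hij ih => exact (ih (by omega)).trans (h j hj)

namespace IsDiscriminant

variable {P : ℝ[X]} {m : ℕ}

theorem natDegree_sq_sub_four (hP : IsDiscriminant P m) : (P ^ 2 - 4).natDegree = 2 * m := by
  rw [← map_ofNat C 4, natDegree_sub_C, natDegree_pow, hP.natDegree_eq]

/-- The $2m$ crossings are roots, and two of them can coincide only as $v_j=u_{j+1}$, squeezed
against the critical point between them. There $(P^2-4)'=2PP'$ vanishes too, so the root is at least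
double. The crossings counted with multiplicity thus already exhaust the degree $2m$. -/
theorem roots_sq_sub_four (hP : IsDiscriminant P m) {c u v : ℕ → ℝ}
    (hc0 : ∀ n, 1 ≤ n → n < m → (derivative P).eval (c n) = 0)
    (h : ∀ n < m, c n ≤ u n ∧ u n < v n ∧ v n ≤ c (n + 1) ∧
      P.eval (u n) = 2 * (-1) ^ (m - n) ∧ P.eval (v n) = -(2 * (-1) ^ (m - n))) :
    (P ^ 2 - 4).roots = ((Multiset.range m).map u) + ((Multiset.range m).map v) := by
  have hne : P ^ 2 - 4 ≠ 0 := by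
    intro h0
    have := hP.natDegree_sq_sub_four
    rw [h0, natDegree_zero] at this
    have := hP.pos
    omega
  have hu : ∀ {i j : ℕ}, i < j → j < m → u i < u j := fun hij hj =>
    strictMono_nat_of_lt_succ_of_lt (fun n hn => (h n (by omega)).2.1.trans_le
      ((h n (by omega)).2.2.1.trans (h (n + 1) hn).1)) hij hj
  have hv : ∀ {i j : ℕ}, i < j → j < m → v i < v j := fun hij hj =>
    strictMono_nat_of_lt_succ_of_lt (fun n hn => (h n (by omega)).2.2.1.trans_lt
      ((h (n + 1) hn).1.trans_lt (h (n + 1) hn).2.1)) hij hj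
  have hnodup : ∀ w : ℕ → ℝ, (∀ {i j : ℕ}, i < j → j < m → w i < w j) →
      ((Multiset.range m).map w).Nodup := by
    intro w hw
    refine Multiset.Nodup.map_on (fun i hi j hj hij => ?_) (Multiset.nodup_range m)
    rw [Multiset.mem_range] at hi hj
    rcases lt_trichotomy i j with h1 | h1 | h1
    · exact absurd hij (hw h1 hj).ne
    · exact h1
    · exact absurd hij (hw h1 hi).ne'
  have hroot : ∀ n < m, (P ^ 2 - 4).IsRoot (u n) ∧ (P ^ 2 - 4).IsRoot (v n) := by
    intro n hn
    obtain ⟨-, -, -, h1, h2⟩ := h n hn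
    have hs : ((-1 : ℝ) ^ (m - n)) ^ 2 = 1 := by rw [← pow_mul, mul_comm, pow_mul]; norm_num
    constructor
    · simp only [IsRoot.def, eval_sub, eval_pow, h1, mul_pow, hs]
      norm_num
    · simp only [IsRoot.def, eval_sub, eval_pow, h2, neg_sq, mul_pow, hs]
      norm_num
  refine (Multiset.eq_of_le_of_card_le (Multiset.le_iff_count.2 fun x => ?_) ?_).symm
  · rw [Multiset.count_add, count_roots]
    have cu := Multiset.nodup_iff_count_le_one.1 (hnodup u hu) x
    have cv := Multiset.nodup_iff_count_le_one.1 (hnodup v hv) x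
    by_cases hxu : x ∈ (Multiset.range m).map u
    · obtain ⟨i, hi, rfl⟩ := Multiset.mem_map.1 hxu
      rw [Multiset.mem_range] at hi
      by_cases hxv : u i ∈ (Multiset.range m).map v
      · obtain ⟨j, hj, hij⟩ := Multiset.mem_map.1 hxv
        rw [Multiset.mem_range] at hj
        have hji : j + 1 = i := by
          rcases lt_trichotomy (j + 1) i with h1 | h1 | h1
          · have := (h j hj).2.2.1.trans (h (j + 1) (by omega)).1
            have := hu h1 hi
            linarith
          · exact h1
          · rcases Nat.lt_or_ge i j with h2 | h2
            · have := hu h2 hj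
              have := (h j hj).2.1
              linarith
            · obtain rfl : j = i := by omega
              have := (h j hj).2.1
              linarith
        have hci : c i = u i := by
          refine le_antisymm (h i hi).1 ?_
          rw [← hij, ← hji]
          exact (h j hj).2.2.1
        have h2 : 1 < (P ^ 2 - 4).rootMultiplicity (u i) := by
          rw [one_lt_rootMultiplicity_iff_isRoot hne]
          refine ⟨(hroot i hi).1, ?_⟩
          have := hc0 i (by omega) hi
          rw [hci] at this
          rw [IsRoot.def, ← map_ofNat C 4, derivative_sub, derivative_C, sub_zero,
            derivative_pow, eval_mul, this, mul_zero]
        omega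
      · rw [Multiset.count_eq_zero_of_notMem hxv]
        have := (rootMultiplicity_pos hne).2 (hroot i hi).1
        omega
    · rw [Multiset.count_eq_zero_of_notMem hxu]
      by_cases hxv : x ∈ (Multiset.range m).map v
      · obtain ⟨j, hj, rfl⟩ := Multiset.mem_map.1 hxv
        rw [Multiset.mem_range] at hj
        have := (rootMultiplicity_pos hne).2 (hroot j hj).2
        omega
      · rw [Multiset.count_eq_zero_of_notMem hxv]
        omega
  · refine (card_roots' _).trans ?_
    rw [hP.natDegree_sq_sub_four, Multiset.card_add, Multiset.card_map, Multiset.card_map,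
      Multiset.card_range]
    omega

/-- The sequence `u_0, v_0, u_1, v_1, …`. -/
def interleave (u v : ℕ → ℝ) (i : ℕ) : ℝ := if i % 2 = 0 then u (i / 2) else v (i / 2)

theorem interleave_even (u v : ℕ → ℝ) (n : ℕ) : interleave u v (2 * n) = u n := by
  simp [interleave]

theorem interleave_odd (u v : ℕ → ℝ) (n : ℕ) : interleave u v (2 * n + 1) = v n := by
  have h1 : (2 * n + 1) % 2 = 1 := by omega
  have h2 : (2 * n + 1) / 2 = n := by omega
  simp [interleave, h1, h2]

theorem map_interleave (u v : ℕ → ℝ) (n : ℕ) :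
    (Multiset.range (2 * n)).map (interleave u v) =
      (Multiset.range n).map u + (Multiset.range n).map v := by
  induction n with
  | zero => simp
  | succ n ih =>
    rw [show 2 * (n + 1) = 2 * n + 1 + 1 by ring]
    simp only [Multiset.range_succ, Multiset.map_cons, ih, interleave_even, interleave_odd,
      Multiset.cons_add, Multiset.add_cons]

theorem sort_roots_sq_sub_four (hP : IsDiscriminant P m) {c u v : ℕ → ℝ}
    (hc0 : ∀ n, 1 ≤ n → n < m → (derivative P).eval (c n) = 0)
    (h : ∀ n < m, c n ≤ u n ∧ u n < v n ∧ v n ≤ c (n + 1) ∧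
      P.eval (u n) = 2 * (-1) ^ (m - n) ∧ P.eval (v n) = -(2 * (-1) ^ (m - n))) :
    (P ^ 2 - 4).roots.sort = (List.range (2 * m)).map (interleave u v) := by
  refine List.Perm.eq_of_pairwise' (r := (· ≤ ·)) (Multiset.pairwise_sort _ _) ?_ ?_
  · rw [List.pairwise_map]
    refine (List.pairwise_lt_range (n := 2 * m)).imp_of_mem ?_
    intro i j _ hj hij
    rw [List.mem_range] at hj
    have step : ∀ n, n + 1 < 2 * m → interleave u v n ≤ interleave u v (n + 1) := by
      intro n hn
      rcases Nat.even_or_odd' n with ⟨l, rfl | rfl⟩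
      · rw [interleave_even, interleave_odd]
        exact (h l (by omega)).2.1.le
      · rw [show 2 * l + 1 + 1 = 2 * (l + 1) by ring, interleave_even, interleave_odd]
        exact (h l (by omega)).2.2.1.trans (h (l + 1) (by omega)).1
    induction j, hij using Nat.le_induction with
    | base => exact step i hj
    | succ j hij ih => exact (ih (by omega)).trans (step j hj)
  · rw [← Multiset.coe_eq_coe, Multiset.sort_eq, hP.roots_sq_sub_four hc0 h, ← map_interleave]
    rfl

/-- The roots of `P² - 4` in increasing order, and their position relative to the critical
points. -/
theorem exists_band_edges (hP : IsDiscriminant P m) {d : Fin (m - 1) → ℝ}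
    (hd : StrictMono d) (hd0 : ∀ i, (derivative P).eval (d i) = 0) :
    ∃ u v : ℕ → ℝ, (P ^ 2 - 4).roots.sort = (List.range (2 * m)).map (interleave u v) ∧
      (∀ n < m, u n < v n ∧ P.eval (u n) = 2 * (-1) ^ (m - n) ∧
        P.eval (v n) = -(2 * (-1) ^ (m - n))) ∧
      ∀ i : Fin (m - 1), v i ≤ d i ∧ d i ≤ u (i + 1) := by
  obtain ⟨c, hc, hc2, hcd⟩ := hP.exists_alternation hd hd0
  obtain ⟨u, v, h⟩ := exists_crossings hc hc2
  refine ⟨u, v, hP.sort_roots_sq_sub_four (c := c) ?_ h, fun n hn => ⟨(h n hn).2.1,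
    (h n hn).2.2.2⟩, fun i => ?_⟩
  · intro n h1 h2
    have := hcd ⟨n - 1, by omega⟩
    simp only [Nat.sub_add_cancel h1] at this
    rw [this]
    exact hd0 _
  · have hi := i.isLt
    rw [← hcd i]
    exact ⟨(h i (by omega)).2.2.1, (h (i + 1) (by omega)).1⟩

/-- Chebyshev's extremal argument. The polynomial $P$ alternates between $\pm 2$ at $m+1$ points,
where $|Q|\le 2$. The divided difference of $P-Q$ over these points is its coefficient of degree
$m$, which is zero as both are monic. All terms of the divided difference are nonnegative, so $P-Q$
vanishes at all $m+1$ points. -/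
theorem eq_of_abs_le_two (hP : IsDiscriminant P m) {Q : ℝ[X]} (hQ : Q.Monic)
    (hQm : Q.natDegree = m) (h : ∀ x, |P.eval x| ≤ 2 → |Q.eval x| ≤ 2) : Q = P := by
  obtain ⟨d, hd, hd0⟩ := hP.exists_critical_points
  obtain ⟨u, v, -, huv, hduv⟩ := hP.exists_band_edges hd hd0
  have hm := hP.pos
  have hu : ∀ n, n + 1 < m → v n ≤ u (n + 1) := fun n hn =>
    (hduv ⟨n, by omega⟩).1.trans (hduv ⟨n, by omega⟩).2
  -- One end of each band, plus the right end of the last band, gives $m+1$ points of alternating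
  -- value.
  let x : Fin (m + 1) → ℝ := fun i => if (i : ℕ) < m then u i else v (m - 1)
  have hx : StrictMono x := by
    refine Fin.strictMono_iff_lt_succ.2 fun i => ?_
    have hi := i.isLt
    simp only [x, Fin.val_castSucc, Fin.val_succ, hi, if_true]
    split_ifs with h1
    · exact (huv i hi).1.trans_le (hu i h1)
    · rw [show m - 1 = (i : ℕ) by omega]
      exact (huv i hi).1
  have hPx : ∀ i, P.eval (x i) = 2 * (-1) ^ (m - (i : ℕ)) := by
    intro i
    simp only [x]
    split_ifs with h1
    · exact (huv i h1).2.1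
    · rw [(huv (m - 1) (by omega)).2.2, show m - (m - 1) = 1 by omega,
        show m - (i : ℕ) = 0 by omega]
      norm_num
  have hlt : (P - Q).degree < m := by
    rw [← hP.natDegree_eq, ← degree_eq_natDegree hP.monic.ne_zero]
    refine degree_sub_lt_left ?_ hP.monic.ne_zero (hP.monic.trans hQ.symm)
    rw [degree_eq_natDegree hP.monic.ne_zero, degree_eq_natDegree hQ.ne_zero, hP.natDegree_eq, hQm]
  have hlt' : (P - Q).degree < (Finset.univ : Finset (Fin (m + 1))).card := by
    rw [Finset.card_univ, Fintype.card_fin]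
    exact hlt.trans (by exact_mod_cast Nat.lt_succ_self m)
  have hsum := Lagrange.coeff_eq_sum (s := Finset.univ) (v := x) hx.injective.injOn hlt'
  rw [Finset.card_univ, Fintype.card_fin, Nat.add_sub_cancel, coeff_eq_zero_of_degree_lt hlt] at hsum
  have hterm : ∀ i ∈ (Finset.univ : Finset (Fin (m + 1))),
      0 ≤ (P - Q).eval (x i) / ∏ j ∈ Finset.univ.erase i, (x i - x j) := by
    intro i _
    have h1 := neg_one_pow_mul_prod_sub_pos hx i
    rw [Nat.add_sub_cancel] at h1
    have h2 := h (x i) (by rw [hPx, abs_mul, abs_neg_one_pow]; norm_num)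
    rw [abs_le] at h2
    rw [eval_sub, hPx]
    rcases neg_one_pow_eq_or ℝ (m - (i : ℕ)) with h3 | h3 <;> rw [h3] at h1 ⊢
    · exact div_nonneg (by linarith [h2.2]) (by linarith)
    · exact div_nonneg_of_nonpos (by linarith [h2.1]) (by linarith)
  have hzero := (Finset.sum_eq_zero_iff_of_nonneg hterm).1 hsum.symm
  have hPQ : P - Q = 0 := by
    refine eq_zero_of_degree_lt_of_eval_index_eq_zero (s := Finset.univ) (v := x) hx.injective.injOn hlt'
      fun i hi => ?_
    have h1 := neg_one_pow_mul_prod_sub_pos hx i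
    refine (div_eq_zero_iff.1 (hzero i hi)).resolve_right ?_
    exact right_ne_zero_of_mul h1.ne'
  exact (sub_eq_zero.1 hPQ).symm

end IsDiscriminant

/-! ### Gaps and critical points of the Lyapunov function -/

section Gaps

variable {k : ℕ} {q : Fin (2 * k) → ℝ} {d : Fin (2 * k - 1) → ℝ}

theorem exists_gap_edges (hP : IsDiscriminant (lyapunov q) (2 * k)) (hd : StrictMono d)
    (hd0 : ∀ i, (derivative (lyapunov q)).eval (d i) = 0) :
    ∃ u v : ℕ → ℝ, (∀ i : Fin (2 * k - 1), gapLeft q (i + 1) = v i ∧ gapRight q (i + 1) = u (i + 1))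
      ∧ (∀ n < 2 * k, u n < v n) ∧ (∀ n < 2 * k, |(lyapunov q).eval (u n)| = 2) ∧
      ∀ i : Fin (2 * k - 1), v i ≤ d i ∧ d i ≤ u (i + 1) := by
  obtain ⟨u, v, hsort, huv, hduv⟩ := hP.exists_band_edges hd hd0
  refine ⟨u, v, fun i => ?_, fun n hn => (huv n hn).1, fun n hn => ?_, hduv⟩
  · have hi := i.isLt
    have h1 : 2 * ((i : ℕ) + 1) - 1 = 2 * i + 1 := by omega
    have h2 : 2 * (i : ℕ) + 1 < 2 * (2 * k) := by omega
    have h3 : 2 * ((i : ℕ) + 1) < 2 * (2 * k) := by omega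
    constructor
    · rw [gapLeft, bandEdges, hsort, h1, List.getD_eq_getElem _ _ (by simpa using h2),
        List.getElem_map, List.getElem_range, IsDiscriminant.interleave_odd]
    · rw [gapRight, bandEdges, hsort, List.getD_eq_getElem _ _ (by simpa using h3),
        List.getElem_map, List.getElem_range, IsDiscriminant.interleave_even]
  · rw [(huv n hn).2.1, abs_mul, abs_neg_one_pow]
    norm_num

/-- The bands $u_n<v_n$ separate the gaps, so $d_i$ is the only critical point in the $i$-th closed
gap and the choice made by `Classical.epsilon` is forced. -/
theorem critPoint_eq (hP : IsDiscriminant (lyapunov q) (2 * k)) (hd : StrictMono d)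
    (hd0 : ∀ i, (derivative (lyapunov q)).eval (d i) = 0) (i : Fin (2 * k - 1)) :
    critPoint q (i + 1) = d i := by
  obtain ⟨u, v, hgap, huv, -, hduv⟩ := exists_gap_edges hP hd hd0
  have hex : ∃ x : ℝ, x ∈ Set.Icc (gapLeft q (i + 1)) (gapRight q (i + 1)) ∧
      (derivative (lyapunov q)).eval x = 0 :=
    ⟨d i, by rw [(hgap i).1, (hgap i).2]; exact hduv i, hd0 i⟩
  obtain ⟨hmem, hzero⟩ := Classical.epsilon_spec hex
  change critPoint q (i + 1) ∈ _ at hmem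
  change (derivative (lyapunov q)).eval (critPoint q (i + 1)) = 0 at hzero
  obtain ⟨j, hj⟩ := (hP.derivative_eval_eq_zero_iff hd hd0 _).1 hzero
  rw [(hgap i).1, (hgap i).2, hj] at hmem
  rw [hj]
  have hi := i.isLt
  have hj' := j.isLt
  rcases lt_trichotomy j i with h | h | h
  · have h1 : d j ≤ u (j + 1) := (hduv j).2
    have h2 : u ((j : ℕ) + 1) < v (j + 1) := huv _ (by omega)
    have h3 : v ((j : ℕ) + 1) ≤ d ⟨j + 1, by omega⟩ := (hduv ⟨j + 1, by omega⟩).1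
    have h4 : d j < v i := by
      rcases Nat.lt_or_ge ((j : ℕ) + 1) i with h5 | h5
      · have h6 : d ⟨j + 1, by omega⟩ ≤ u ((j : ℕ) + 1 + 1) := (hduv ⟨j + 1, by omega⟩).2
        have h7 : d ⟨j + 1, by omega⟩ ≤ d ⟨i - 1, by omega⟩ := hd.monotone (by
          rw [Fin.mk_le_mk]; omega)
        have h8 : d ⟨i - 1, by omega⟩ ≤ u (i - 1 + 1) := (hduv ⟨i - 1, by omega⟩).2
        rw [show (i : ℕ) - 1 + 1 = i by omega] at h8
        have := huv i (by omega)
        linarith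
      · have h6 : (j : ℕ) + 1 = i := by
          have : (j : ℕ) < i := h
          omega
        rw [← h6]
        linarith
    exact absurd hmem.1 (not_le.2 h4)
  · rw [h]
  · have h1 : u ((i : ℕ) + 1) < v (i + 1) := huv _ (by omega)
    have h2 : v ((i : ℕ) + 1) ≤ d ⟨i + 1, by omega⟩ := (hduv ⟨i + 1, by omega⟩).1
    have h3 : d ⟨i + 1, by omega⟩ ≤ d j := hd.monotone (by
      rw [← Fin.val_fin_le]
      exact h)
    linarith [hmem.2]

theorem gapLeft_lt_gapRight (hP : IsDiscriminant (lyapunov q) (2 * k)) (hd : StrictMono d)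
    (hd0 : ∀ i, (derivative (lyapunov q)).eval (d i) = 0) (i : Fin (2 * k - 1))
    (h : 2 < |(lyapunov q).eval (d i)|) : gapLeft q (i + 1) < gapRight q (i + 1) := by
  obtain ⟨u, v, hgap, -, hval, hduv⟩ := exists_gap_edges hP hd hd0
  have hi := i.isLt
  rw [(hgap i).1, (hgap i).2]
  refine (hduv i).1.trans_lt (lt_of_le_of_ne (hduv i).2 fun heq => ?_)
  rw [heq, hval _ (by omega)] at h
  exact lt_irrefl _ h

end Gaps

/-! ### Self-adjointness and the discriminant of the operator -/

theorem shift_apply (j : ℤ) (y : Ell2) (n : ℤ) : shift j y n = y (n + j) := rfl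

theorem norm_shift_le (j : ℤ) : ‖shift j‖ ≤ 1 := LinearMap.mkContinuous_norm_le _ zero_le_one _

theorem inner_shift_left (j : ℤ) (x y : Ell2) :
    inner ℂ (shift j x) y = inner ℂ x (shift (-j) y) := by
  rw [lp.inner_eq_tsum, lp.inner_eq_tsum,
    ← (Equiv.addRight j).tsum_eq fun n => inner ℂ (x n) (shift (-j) y n)]
  refine tsum_congr fun n => ?_
  simp [shift_apply]

theorem inner_mulPotential_left {k : ℕ} (q : Fin (2 * k) → ℝ) (x y : Ell2) :
    inner ℂ (mulPotential q x) y = inner ℂ x (mulPotential q y) := by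
  rw [lp.inner_eq_tsum, lp.inner_eq_tsum]
  refine tsum_congr fun n => ?_
  have h : ∀ z : Ell2, mulPotential q z n = (periodicExt q n : ℂ) * z n := fun z => rfl
  rw [h, h, RCLike.inner_apply, RCLike.inner_apply, map_mul, Complex.conj_ofReal]
  ring

theorem isSelfAdjoint_shift_add_shift (j : ℤ) : IsSelfAdjoint (shift j + shift (-j)) := by
  rw [ContinuousLinearMap.isSelfAdjoint_iff_isSymmetric]
  intro x y
  change inner ℂ (shift j x + shift (-j) x) y = inner ℂ x (shift j y + shift (-j) y)
  rw [inner_add_left, inner_add_right, inner_shift_left, inner_shift_left, neg_neg, add_comm]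

theorem isSelfAdjoint_schrodinger {k : ℕ} (q : Fin (2 * k) → ℝ) :
    IsSelfAdjoint (schrodinger q) := by
  have h1 := isSelfAdjoint_shift_add_shift (-1)
  have h2 : IsSelfAdjoint (mulPotential q) := by
    rw [ContinuousLinearMap.isSelfAdjoint_iff_isSymmetric]
    exact fun x y => inner_mulPotential_left q x y
  rw [neg_neg] at h1
  exact h1.add h2

/-- The fundamental solutions with complex coefficients. -/
noncomputable def fundSolC {k : ℕ} (q : Fin (2 * k) → ℝ) (a b : ℝ[X]) (n : ℕ) : ℂ[X] :=
  (fundSol q a b n).map (algebraMap ℝ ℂ)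

theorem fundSolC_add_two {k : ℕ} (q : Fin (2 * k) → ℝ) (a b : ℝ[X]) (n : ℕ) :
    fundSolC q a b (n + 2) =
      (X - C (periodicExt q ((n + 1 : ℕ) : ℤ) : ℂ)) * fundSolC q a b (n + 1) -
        fundSolC q a b n := by
  simp [fundSolC, fundSol_add_two]

theorem wronskian_fundSolC {k : ℕ} (q : Fin (2 * k) → ℝ) (n : ℕ) :
    fundSolC q 0 1 (n + 1) * fundSolC q 1 0 n - fundSolC q 0 1 n * fundSolC q 1 0 (n + 1) = 1 := by
  simp only [fundSolC, ← Polynomial.map_mul, ← Polynomial.map_sub, wronskian_fundSol,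
    Polynomial.map_one]

section Discriminant

variable {k : ℕ} (q : Fin (2 * k) → ℝ)

/-- Any $y$ satisfies $y_{n+1}=(Ly)_n-q_ny_n-y_{n-1}$, which is the recurrence with $L$ in the role
of $\lambda$. So $y_n$ is recovered from the sites $0$ and $1$ by inserting $L$ into the fundamental
solutions. -/
theorem apply_eq_aeval_fundSolC (n : ℕ) (y : Ell2) :
    y n = aeval (schrodinger q) (fundSolC q 0 1 n) y 1 +
      aeval (schrodinger q) (fundSolC q 1 0 n) y 0 := by
  have key : ∀ n : ℕ, (∀ y : Ell2, y n = aeval (schrodinger q) (fundSolC q 0 1 n) y 1 +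
      aeval (schrodinger q) (fundSolC q 1 0 n) y 0) ∧
      ∀ y : Ell2, y (n + 1 : ℕ) = aeval (schrodinger q) (fundSolC q 0 1 (n + 1)) y 1 +
        aeval (schrodinger q) (fundSolC q 1 0 (n + 1)) y 0 := by
    intro n
    induction n with
    | zero => constructor <;> intro y <;> simp [fundSolC, fundSol]
    | succ n ih =>
      refine ⟨ih.2, fun y => ?_⟩
      have hstep : ∀ (a b : ℝ[X]) (j : ℤ),
          aeval (schrodinger q) (fundSolC q a b (n + 1 + 1)) y j =
            aeval (schrodinger q) (fundSolC q a b (n + 1)) (schrodinger q y) j -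
            (periodicExt q ((n + 1 : ℕ) : ℤ) : ℂ) *
              aeval (schrodinger q) (fundSolC q a b (n + 1)) y j -
            aeval (schrodinger q) (fundSolC q a b n) y j := by
        intro a b j
        rw [fundSolC_add_two, sub_mul, mul_comm X, map_sub, map_sub, map_mul, aeval_X, map_mul,
          aeval_C]
        rfl
      rw [hstep, hstep]
      have h1 := ih.2 (schrodinger q y)
      rw [schrodinger_apply] at h1
      have e1 : ((n + 1 : ℕ) : ℤ) - 1 = (n : ℤ) := by push_cast; ring
      have e2 : ((n + 1 : ℕ) : ℤ) + 1 = ((n + 1 + 1 : ℕ) : ℤ) := by push_cast; ring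
      rw [e1, e2] at h1
      linear_combination h1 - (periodicExt q ((n + 1 : ℕ) : ℤ) : ℂ) * ih.2 y - ih.1 y
  exact (key n).1 y

theorem commute_schrodinger_shift (q : Fin (2 * k) → ℝ) :
    Commute (schrodinger q) (shift (2 * k : ℕ)) := by
  refine ContinuousLinearMap.ext fun y => ?_
  ext n
  change schrodinger q (shift (2 * k : ℕ) y) n = schrodinger q y (n + (2 * k : ℕ))
  rw [schrodinger_apply, schrodinger_apply, shift_apply, shift_apply, shift_apply,
    periodicExt_add_period, sub_add_eq_add_sub, add_right_comm n 1]

theorem commute_schrodinger_shift_neg (q : Fin (2 * k) → ℝ) :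
    Commute (schrodinger q) (shift (-(2 * k : ℕ))) := by
  refine ContinuousLinearMap.ext fun y => ?_
  ext n
  change schrodinger q (shift (-(2 * k : ℕ)) y) n = schrodinger q y (n + -(2 * k : ℕ))
  have h := periodicExt_add_period q (n + -(2 * k : ℕ))
  rw [neg_add_cancel_right] at h
  rw [schrodinger_apply, schrodinger_apply, shift_apply, shift_apply, shift_apply, h, sub_add_eq_add_sub,
    add_right_comm n 1]

theorem commute_aeval {A : Type*} [Ring A] [Algebra ℂ A] {a b : A} (h : Commute a b) (f : ℂ[X]) :
    Commute (aeval a f) b := by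
  induction f using Polynomial.induction_on' with
  | add f g hf hg => rw [map_add]; exact hf.add_left hg
  | monomial n c =>
    rw [aeval_monomial]
    exact (Algebra.commute_algebraMap_left c b).mul_left (h.pow_left n)

/-- The Lyapunov function with complex coefficients. -/
noncomputable def lyapunovC {k : ℕ} (q : Fin (2 * k) → ℝ) : ℂ[X] :=
  (lyapunov q).map (algebraMap ℝ ℂ)

theorem lyapunovC_eq : lyapunovC q = fundSolC q 0 1 (2 * k + 1) + fundSolC q 1 0 (2 * k) := by
  simp [lyapunovC, lyapunov, fundSolC]

/-- Let $z$ be $y$ moved by one period, so that sites $0,1$ of $y$ are sites $2k,2k+1$ of $z$.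
Expanding both and eliminating with the Wronskian leaves only the two translates of $y$. -/
theorem aeval_lyapunovC_apply_zero_one (y : Ell2) :
    aeval (schrodinger q) (lyapunovC q) y 0 = y (2 * k : ℕ) + y (-(2 * k : ℕ)) ∧
    aeval (schrodinger q) (lyapunovC q) y 1 = y (1 + (2 * k : ℕ)) + y (1 + -(2 * k : ℕ)) := by
  set L := schrodinger q
  set z : Ell2 := shift (-(2 * k : ℕ)) y with hz
  have hshift : ∀ (f : ℂ[X]) (j : ℤ), aeval L f z (j + (2 * k : ℕ)) = aeval L f y j := by
    intro f j
    have h := DFunLike.congr_fun (commute_aeval (commute_schrodinger_shift_neg q) f).eq y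
    have h2 : aeval L f z = shift (-(2 * k : ℕ)) (aeval L f y) := h
    rw [h2, shift_apply, add_neg_cancel_right]
  have hzy : ∀ j : ℤ, z j = y (j + -(2 * k : ℕ)) := fun j => rfl
  have hmul : ∀ (f g : ℂ[X]) (x : Ell2), aeval L f (aeval L g x) = aeval L (f * g) x := by
    intro f g x
    rw [map_mul]
    rfl
  have hW := wronskian_fundSolC q (2 * k)
  set A := fundSolC q 0 1 (2 * k + 1)
  set B := fundSolC q 1 0 (2 * k + 1)
  set A' := fundSolC q 0 1 (2 * k)
  set B' := fundSolC q 1 0 (2 * k)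
  have e1 : ∀ x : Ell2, x ((2 * k : ℕ) : ℤ) = aeval L A' x 1 + aeval L B' x 0 :=
    fun x => apply_eq_aeval_fundSolC q (2 * k) x
  have e2 : ∀ x : Ell2, x (1 + (2 * k : ℕ) : ℤ) = aeval L A x 1 + aeval L B x 0 := by
    intro x
    have := apply_eq_aeval_fundSolC q (2 * k + 1) x
    rwa [Nat.cast_add, Nat.cast_one, add_comm ((2 * k : ℕ) : ℤ)] at this
  have hWz : ∀ j : ℤ, aeval L (A * B') z j - aeval L (A' * B) z j = z j := by
    intro j
    have := congrArg (fun f => aeval L f z j) hW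
    simpa using this
  rw [lyapunovC_eq]
  change aeval L (A + B') y 0 = _ ∧ aeval L (A + B') y 1 = _
  rw [map_add]
  constructor
  · change aeval L A y 0 + aeval L B' y 0 = _
    have h1 := hshift A 0
    have h2 := hshift A' 1
    rw [zero_add, e1, hmul, hmul] at h1
    rw [e2, hmul, hmul] at h2
    have h3 := hWz 0
    rw [hzy, zero_add] at h3
    rw [e1 y, ← h3, mul_comm A' A] at *
    rw [mul_comm A B', mul_comm A' B]
    linear_combination h2 - h1
  · change aeval L A y 1 + aeval L B' y 1 = _
    have h1 := hshift B 0
    have h2 := hshift B' 1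
    rw [zero_add, e1, hmul, hmul] at h1
    rw [e2, hmul, hmul] at h2
    have h3 := hWz 1
    rw [hzy] at h3
    rw [e2 y, ← h3]
    rw [mul_comm B B'] at h2
    linear_combination h1 - h2

/-- The difference $W$ of the two sides commutes with $L$ and annihilates the sites $0$ and $1$ of
every vector. The identity $W(Ly)=L(Wy)$ propagates this to all sites in both directions. -/
theorem aeval_lyapunovC : aeval (schrodinger q) (lyapunovC q) =
    shift (2 * k : ℕ) + shift (-(2 * k : ℕ)) := by
  set L := schrodinger q with hL
  set W := aeval L (lyapunovC q) - (shift (2 * k : ℕ) + shift (-(2 * k : ℕ))) with hWdef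
  have hcomm : Commute L W := by
    refine Commute.sub_right (commute_aeval (Commute.refl L) _).symm ?_
    exact (commute_schrodinger_shift q).add_right (commute_schrodinger_shift_neg q)
  have hrec : ∀ (y : Ell2) (n : ℤ),
      W (L y) n = W y (n - 1) + W y (n + 1) + (periodicExt q n : ℂ) * W y n := by
    intro y n
    have h : L (W y) = W (L y) := DFunLike.congr_fun hcomm.eq y
    rw [← h, hL, schrodinger_apply]
  have h01 : ∀ y : Ell2, W y 0 = 0 ∧ W y 1 = 0 := by
    intro y
    have h := aeval_lyapunovC_apply_zero_one q y
    constructor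
    · change aeval L (lyapunovC q) y 0 - (y (0 + (2 * k : ℕ)) + y (0 + -(2 * k : ℕ))) = 0
      rw [h.1, zero_add, zero_add, sub_self]
    · change aeval L (lyapunovC q) y 1 - (y (1 + (2 * k : ℕ)) + y (1 + -(2 * k : ℕ))) = 0
      rw [h.2, sub_self]
  have hall : ∀ n : ℤ, ∀ y : Ell2, W y n = 0 ∧ W y (n + 1) = 0 := by
    intro n
    induction n using Int.induction_on with
    | zero => exact h01
    | succ n ih =>
      refine fun y => ⟨(ih y).2, ?_⟩
      have h := hrec y (n + 1)
      rw [(ih (L y)).2, add_sub_cancel_right, (ih y).1, (ih y).2] at h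
      simpa using h.symm
    | pred n ih =>
      refine fun y => ⟨?_, by rw [sub_add_cancel]; exact (ih y).1⟩
      have h := hrec y (-n)
      rw [(ih (L y)).1, (ih y).1, (ih y).2] at h
      simpa using h.symm
  have hW : W = 0 := by
    refine ContinuousLinearMap.ext fun y => ?_
    ext n
    exact (hall n y).1
  exact sub_eq_zero.1 hW

/-- By spectral mapping $\Delta(z)$ lies in the spectrum of $T^{2k}+T^{-2k}$, a self-adjoint
operator of norm at most $2$. -/
theorem exists_eval_lyapunovC_eq {z : ℂ} (hz : z ∈ spectrum ℂ (schrodinger q)) :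
    ∃ t : ℝ, |t| ≤ 2 ∧ (lyapunovC q).eval z = t := by
  have h1 : (lyapunovC q).eval z ∈ spectrum ℂ (shift (2 * k : ℕ) + shift (-(2 * k : ℕ))) := by
    rw [← aeval_lyapunovC]
    exact spectrum.subset_polynomial_aeval _ _ ⟨z, hz, rfl⟩
  have h2 := (isSelfAdjoint_shift_add_shift (2 * k : ℕ)).mem_spectrum_eq_re h1
  refine ⟨((lyapunovC q).eval z).re, (Complex.abs_re_le_norm _).trans ?_, h2⟩
  refine (spectrum.norm_le_norm_mul_of_mem h1).trans ?_
  have h3 : ‖(1 : Ell2 →L[ℂ] Ell2)‖ ≤ 1 := ContinuousLinearMap.norm_id_le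
  refine (mul_le_of_le_one_right (norm_nonneg _) h3).trans ((norm_add_le _ _).trans ?_)
  linarith [norm_shift_le (2 * k : ℕ), norm_shift_le (-(2 * k : ℕ))]

end Discriminant

/-! ### Floquet solutions and the spectrum -/

theorem sum_range_mul_periodic {f : ℕ → ℝ} {p : ℕ} (hf : ∀ n, f (n + p) = f n) (K : ℕ) :
    ∑ n ∈ Finset.range (p * K), f n = K * ∑ n ∈ Finset.range p, f n := by
  have h : ∀ K n, f (p * K + n) = f n := by
    intro K n
    induction K with
    | zero => simp
    | succ K ih => rw [mul_add_one, add_right_comm, hf, ih]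
  induction K with
  | zero => simp
  | succ K ih =>
    rw [mul_add_one, Finset.sum_range_add, ih]
    simp only [h]
    push_cast
    ring

section Floquet

variable {k : ℕ} (q : Fin (2 * k) → ℝ)

/-- A nonzero solution with `y_{n+2k} = ζ y_n`, `|ζ| = 1`, forces `z` into the spectrum. -/
theorem mem_spectrum_of_floquet (hk : 1 ≤ k) {z ζ : ℂ} (hζ : ‖ζ‖ = 1) {y : ℕ → ℂ}
    (hrec : ∀ n, y (n + 2) = (z - periodicExt q ((n + 1 : ℕ) : ℤ)) * y (n + 1) - y n)
    (hper : ∀ n, y (n + 2 * k) = ζ * y n) (hne : y 0 ≠ 0 ∨ y 1 ≠ 0) :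
    z ∈ spectrum ℂ (schrodinger q) := by
  let e : ℤ → Ell2 := fun j => lp.single 2 j (1 : ℂ)
  have hLe : ∀ j : ℤ, schrodinger q (e j) = e (j - 1) + e (j + 1) + (periodicExt q j : ℂ) • e j := by
    intro j
    ext n
    rw [schrodinger_apply]
    have h1 : (n - 1 = j) = (n = j + 1) := by rw [sub_eq_iff_eq_add]
    have h2 : (n + 1 = j) = (n = j - 1) := by rw [eq_sub_iff_add_eq]
    simp only [e, lp.coeFn_add, lp.coeFn_smul, Pi.add_apply, Pi.smul_apply, lp.single_apply,
      Pi.single_apply, h1, h2, smul_eq_mul]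
    by_cases h : n = j
    · subst h
      simp [add_comm]
    · simp [h, add_comm]
  -- The Floquet solution cut off to the sites $1,\dots,N$. Applying $L-z$ leaves only boundary
  -- terms, bounded along multiples of the period, whereas the squared norm grows linearly; this
  -- contradicts a bounded inverse.
  let u : ℕ → Ell2 := fun N => ∑ n ∈ Finset.range N, y (n + 1) • e (n + 1 : ℕ)
  have hu : ∀ N : ℕ, schrodinger q (u N) - z • u N =
      y 1 • e 0 - y 0 • e 1 - y (N + 1) • e N + y N • e (N + 1 : ℕ) := by
    intro N
    induction N with
    | zero => simp [u]
    | succ N ih =>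
      have hstep : u (N + 1) = u N + y (N + 1) • e (N + 1 : ℕ) := Finset.sum_range_succ _ _
      rw [hstep, map_add, map_smul, hLe, smul_add z, add_sub_add_comm, ih, hrec]
      have e1 : ((N + 1 : ℕ) : ℤ) - 1 = N := by push_cast; ring
      have e2 : ((N + 1 : ℕ) : ℤ) + 1 = ((N + 1 + 1 : ℕ) : ℤ) := by push_cast; ring
      rw [e1, e2]
      module
  have hnorm : ∀ N : ℕ, ‖u N‖ ^ 2 = ∑ n ∈ Finset.range N, ‖y (n + 1)‖ ^ 2 := by
    intro N
    have hinj : Set.InjOn (fun n : ℕ => ((n + 1 : ℕ) : ℤ)) (Finset.range N) := by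
      intro a _ b _ hab
      simpa using hab
    have h1 : u N = ∑ i ∈ (Finset.range N).image (fun n : ℕ => ((n + 1 : ℕ) : ℤ)),
        lp.single 2 i (y i.toNat) := by
      rw [Finset.sum_image hinj]
      refine Finset.sum_congr rfl fun n _ => ?_
      rw [Int.toNat_natCast, ← lp.single_smul, smul_eq_mul, mul_one]
    have h2 := lp.norm_sum_single (p := 2) (E := fun _ : ℤ => ℂ) (by norm_num)
      (fun i => y i.toNat) ((Finset.range N).image (fun n : ℕ => ((n + 1 : ℕ) : ℤ)))
    rw [← h1, Finset.sum_image hinj] at h2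
    simpa using h2
  set A : ℝ := ∑ n ∈ Finset.range (2 * k), ‖y (n + 1)‖ ^ 2 with hA
  have hperN : ∀ n, ‖y (n + 2 * k)‖ = ‖y n‖ := fun n => by rw [hper, norm_mul, hζ, one_mul]
  have hApos : 0 < A := by
    rcases hne with h | h
    · refine (Finset.sum_pos_iff_of_nonneg fun n _ => by positivity).2
        ⟨2 * k - 1, Finset.mem_range.2 (by omega), ?_⟩
      have := hperN 0
      rw [zero_add] at this
      rw [Nat.sub_add_cancel (by omega), this]
      positivity
    · refine (Finset.sum_pos_iff_of_nonneg fun n _ => by positivity).2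
        ⟨0, Finset.mem_range.2 (by omega), ?_⟩
      positivity
  have hgrow : ∀ K : ℕ, ‖u (2 * k * K)‖ ^ 2 = K * A := by
    intro K
    rw [hnorm, sum_range_mul_periodic]
    intro n
    rw [add_right_comm, hperN]
  have hperK : ∀ K n : ℕ, ‖y (2 * k * K + n)‖ = ‖y n‖ := by
    intro K n
    induction K with
    | zero => simp
    | succ K ih => rw [mul_add_one, add_right_comm, hperN, ih]
  have he : ∀ (c : ℂ) (j : ℤ), ‖c • e j‖ = ‖c‖ := by
    intro c j
    rw [norm_smul, lp.norm_single (by norm_num), norm_one, mul_one]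
  have hbound : ∀ K : ℕ, ‖schrodinger q (u (2 * k * K)) - z • u (2 * k * K)‖ ≤
      2 * (‖y 0‖ + ‖y 1‖) := by
    intro K
    rw [hu]
    refine (norm_add_le _ _).trans ((add_le_add_left ((norm_sub_le _ _).trans
      (add_le_add_left (norm_sub_le _ _) _)) _).trans ?_)
    rw [he, he, he, he, hperK]
    have := hperK K 0
    rw [add_zero] at this
    rw [this]
    linarith
  by_contra hz
  obtain ⟨R, hR⟩ := (spectrum.notMem_iff.1 hz).exists_left_inv
  have hback : ∀ x : Ell2, ‖x‖ ≤ ‖R‖ * ‖schrodinger q x - z • x‖ := by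
    intro x
    have h1 : R ((algebraMap ℂ (Ell2 →L[ℂ] Ell2) z - schrodinger q) x) = x :=
      DFunLike.congr_fun hR x
    have h2 : (algebraMap ℂ (Ell2 →L[ℂ] Ell2) z - schrodinger q) x =
        z • x - schrodinger q x := rfl
    rw [norm_sub_rev, ← h2]
    conv_lhs => rw [← h1]
    exact R.le_opNorm _
  set M : ℝ := ‖R‖ * (2 * (‖y 0‖ + ‖y 1‖)) with hM
  obtain ⟨K, hK⟩ := exists_nat_gt (M ^ 2 / A)
  rw [div_lt_iff₀ hApos, ← hgrow] at hK
  have h1 : ‖u (2 * k * K)‖ ≤ M :=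
    (hback _).trans (mul_le_mul_of_nonneg_left (hbound K) (norm_nonneg _))
  have h2 := pow_le_pow_left₀ (norm_nonneg _) h1 2
  linarith

theorem mem_spectrum_of_eval_lyapunovC (hk : 1 ≤ k) {z : ℂ} {t : ℝ} (ht : |t| ≤ 2)
    (hz : (lyapunovC q).eval z = t) : z ∈ spectrum ℂ (schrodinger q) := by
  have ht2 : t ^ 2 ≤ 4 := by
    have := abs_le.1 ht
    nlinarith [this.1, this.2]
  set s : ℝ := √(1 - t ^ 2 / 4) with hs
  have hs2 : s ^ 2 = 1 - t ^ 2 / 4 := Real.sq_sqrt (by linarith)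
  set ζ : ℂ := ⟨t / 2, s⟩ with hζdef
  have hζ1 : ‖ζ‖ = 1 := by
    have h : Complex.normSq ζ = 1 := by
      rw [Complex.normSq_apply]
      simp only [hζdef]
      linarith
    rw [Complex.norm_def, h, Real.sqrt_one]
  have hζ2 : ζ ^ 2 - t * ζ + 1 = 0 := by
    apply Complex.ext <;> simp [hζdef, pow_two] <;> nlinarith
  have hW := congrArg (fun f => f.eval z) (wronskian_fundSolC q (2 * k))
  rw [lyapunovC_eq] at hz
  simp only [eval_sub, eval_mul, eval_one, eval_add] at hW hz
  set a := fun n => (fundSolC q 0 1 n).eval z with ha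
  set b := fun n => (fundSolC q 1 0 n).eval z with hb
  -- The number $\zeta$ is an eigenvalue of the monodromy matrix, whose trace is $t$ and determinant
  -- is $1$; an eigenvector provides the initial data $(y_1,y_0)$ of a Floquet solution.
  have hdet : Matrix.det !![a (2 * k + 1) - ζ, b (2 * k + 1); a (2 * k), b (2 * k) - ζ] = 0 := by
    rw [Matrix.det_fin_two_of]
    linear_combination hW - ζ * hz + hζ2
  obtain ⟨v, hv, hv0⟩ := Matrix.exists_mulVec_eq_zero_iff.2 hdet
  have hv1 := congrFun hv0 0
  have hv2 := congrFun hv0 1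
  simp [Matrix.mulVec, dotProduct, Fin.sum_univ_two] at hv1 hv2
  let y : ℕ → ℂ := fun n => a n * v 0 + b n * v 1
  have harec : ∀ (c d : ℝ[X]) n, (fundSolC q c d (n + 2)).eval z =
      (z - periodicExt q ((n + 1 : ℕ) : ℤ)) * (fundSolC q c d (n + 1)).eval z -
        (fundSolC q c d n).eval z := by
    intro c d n
    rw [fundSolC_add_two]
    simp
  have hrec : ∀ n, y (n + 2) = (z - periodicExt q ((n + 1 : ℕ) : ℤ)) * y (n + 1) - y n := by
    intro n
    simp only [y, ha, hb, harec]
    ring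
  have hy0 : y 0 = v 1 := by simp [y, ha, hb, fundSolC, fundSol]
  have hy1 : y 1 = v 0 := by simp [y, ha, hb, fundSolC, fundSol]
  have hper : ∀ n, y (n + 2 * k) = ζ * y n ∧ y (n + 1 + 2 * k) = ζ * y (n + 1) := by
    intro n
    induction n with
    | zero =>
      rw [zero_add, zero_add, hy0, hy1, add_comm 1]
      simp only [y]
      exact ⟨by linear_combination hv2, by linear_combination hv1⟩
    | succ n ih =>
      refine ⟨ih.2, ?_⟩
      have h := periodicExt_add_period q ((n + 1 : ℕ) : ℤ)
      rw [← Nat.cast_add] at h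
      rw [show n + 1 + 1 + 2 * k = n + 2 * k + 2 by ring, hrec,
        show n + 2 * k + 1 = n + 1 + 2 * k by ring, h, ih.1, ih.2, hrec]
      ring
  refine mem_spectrum_of_floquet q hk hζ1 hrec (fun n => (hper n).1) ?_
  rw [hy0, hy1]
  by_contra! h
  exact hv (by ext i; fin_cases i <;> simp [h.1, h.2])

theorem mem_spectrum_iff (hk : 1 ≤ k) (z : ℂ) :
    z ∈ spectrum ℂ (schrodinger q) ↔ ∃ t : ℝ, |t| ≤ 2 ∧ (lyapunovC q).eval z = t :=
  ⟨exists_eval_lyapunovC_eq q, fun ⟨_, ht, hz⟩ => mem_spectrum_of_eval_lyapunovC q hk ht hz⟩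

theorem ofReal_mem_spectrum_iff (hk : 1 ≤ k) (x : ℝ) :
    (x : ℂ) ∈ spectrum ℂ (schrodinger q) ↔ |(lyapunov q).eval x| ≤ 2 := by
  have h : (lyapunovC q).eval (x : ℂ) = ((lyapunov q).eval x : ℝ) := by
    rw [lyapunovC]
    exact (eval_map _ _).trans (eval₂_at_apply (algebraMap ℝ ℂ) x)
  rw [mem_spectrum_iff q hk, h]
  constructor
  · rintro ⟨t, ht, hz⟩
    rwa [Complex.ofReal_injective hz]
  · exact fun h => ⟨_, h, rfl⟩

/-- Every complex root belongs to the spectrum of a self-adjoint operator, hence is real. -/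
theorem splits_lyapunov_sub (hk : 1 ≤ k) {t : ℝ} (ht : |t| ≤ 2) : (lyapunov q - C t).Splits := by
  refine Splits.of_splits_map (algebraMap ℝ ℂ) (IsAlgClosed.splits _) fun z hz => ?_
  have h1 : (lyapunovC q).eval z = t := by
    have := isRoot_of_mem_roots hz
    rw [IsRoot.def, Polynomial.map_sub, eval_sub, map_C, eval_C, sub_eq_zero] at this
    exact this
  have h2 := (mem_spectrum_iff q hk z).2 ⟨t, ht, h1⟩
  exact ⟨z.re, ((isSelfAdjoint_schrodinger q).mem_spectrum_eq_re h2).symm⟩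

theorem isDiscriminant_lyapunov (hk : 1 ≤ k) : IsDiscriminant (lyapunov q) (2 * k) where
  monic := monic_lyapunov hk q
  natDegree_eq := natDegree_lyapunov hk q
  even := even_two_mul k
  pos := by omega
  splits_sub := splits_lyapunov_sub q hk (by norm_num)
  splits_add := by
    have := splits_lyapunov_sub q hk (t := -2) (by norm_num)
    rwa [C_neg, sub_neg_eq_add] at this

end Floquet

theorem spectrum_eq_iff {k : ℕ} (hk : 1 ≤ k) (p q : Fin (2 * k) → ℝ) :
    spectrum ℂ (schrodinger q) = spectrum ℂ (schrodinger p) ↔ lyapunov q = lyapunov p := by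
  constructor
  · intro h
    refine (isDiscriminant_lyapunov p hk).eq_of_abs_le_two (monic_lyapunov hk q)
      (natDegree_lyapunov hk q) fun x hx => ?_
    rwa [← ofReal_mem_spectrum_iff q hk, h, ofReal_mem_spectrum_iff p hk]
  · intro h
    ext z
    rw [mem_spectrum_iff q hk, mem_spectrum_iff p hk, lyapunovC, lyapunovC, h]

/-! ### Dependence of the critical values on the potential -/

theorem eval_derivative_evenPoly {k : ℕ} (a : Fin k → ℝ) (t : ℝ) :
    (derivative (evenPoly a)).eval t = (2 * k : ℕ) * t ^ (2 * k - 1) +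
      ∑ j : Fin k, a j * ((2 * (k - 1 - (j : ℕ)) : ℕ) * t ^ (2 * (k - 1 - (j : ℕ)) - 1)) := by
  simp [evenPoly, derivative_X_pow, eval_finsetSum]

theorem contDiff_eval_derivative_evenPoly {k : ℕ} {N : WithTop ℕ∞} :
    ContDiff ℝ N fun p : (Fin k → ℝ) × ℝ => (derivative (evenPoly p.1)).eval p.2 := by
  simp only [eval_derivative_evenPoly]
  fun_prop

theorem hasFDerivAt_coeffMap {k : ℕ} (x : Fin k → ℝ) :
    HasFDerivAt (coeffMap k) (fderiv ℝ (coeffMap k) x) x :=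
  ((contDiff_coeffMap (N := 1)).differentiable one_ne_zero x).hasFDerivAt

/-- The derivative of the value of `Δ` at a fixed point with respect to the potential. -/
noncomputable def valueDeriv {k : ℕ} (x : Fin k → ℝ) (t : ℝ) : (Fin k → ℝ) →L[ℝ] ℝ :=
  ∑ j : Fin k,
    t ^ (2 * (k - 1 - (j : ℕ))) • (ContinuousLinearMap.proj j).comp (fderiv ℝ (coeffMap k) x)

theorem valueDeriv_apply {k : ℕ} (x : Fin k → ℝ) (t : ℝ) (v : Fin k → ℝ) :
    valueDeriv x t v =
      ∑ j : Fin k, fderiv ℝ (coeffMap k) x v j * t ^ (2 * (k - 1 - (j : ℕ))) := by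
  simp [valueDeriv, mul_comm]

/-- When $\psi(x)$ is a critical point the second summand drops out, so critical values vary as if
the critical point were fixed. -/
theorem hasFDerivAt_eval_lyapunov {k : ℕ} (hk : 1 ≤ k) {x : Fin k → ℝ} {ψ : (Fin k → ℝ) → ℝ}
    {ψ' : (Fin k → ℝ) →L[ℝ] ℝ} (hψ : HasFDerivAt ψ ψ' x) :
    HasFDerivAt (fun y => (lyapunov (ofFirstHalf y)).eval (ψ y))
      (valueDeriv x (ψ x) + (derivative (lyapunov (ofFirstHalf x))).eval (ψ x) • ψ') x := by
  simp only [lyapunov_ofFirstHalf hk, eval_evenPoly, eval_derivative_evenPoly]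
  have hΦ := hasFDerivAt_pi'.1 (hasFDerivAt_coeffMap x)
  have h := (hψ.pow (2 * k)).add (HasFDerivAt.fun_sum (u := Finset.univ) fun (j : Fin k) _ =>
    (hΦ j).mul (hψ.pow (2 * (k - 1 - (j : ℕ)))))
  refine h.congr_fderiv ?_
  ext v
  simp [valueDeriv_apply, Finset.sum_add_distrib, add_mul, Finset.sum_mul]
  ring_nf

theorem isInvertible_of_apply_one_ne_zero {f : ℝ →L[ℝ] ℝ} (hf : f 1 ≠ 0) : f.IsInvertible :=
  ⟨ContinuousLinearEquiv.unitsEquivAut ℝ (Units.mk0 (f 1) hf), by ext; simp⟩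

/-- A simple critical point depends differentiably on the potential. -/
theorem exists_differentiable_critical_point {k : ℕ} (hk : 1 ≤ k) {x : Fin k → ℝ} {t : ℝ}
    (ht : (derivative (lyapunov (ofFirstHalf x))).eval t = 0) :
    ∃ ψ : (Fin k → ℝ) → ℝ, DifferentiableAt ℝ ψ x ∧ ψ x = t ∧
      ∀ᶠ y in 𝓝 x, (derivative (lyapunov (ofFirstHalf y))).eval (ψ y) = 0 := by
  set F : (Fin k → ℝ) × ℝ → ℝ := fun p => (derivative (lyapunov (ofFirstHalf p.1))).eval p.2
    with hF
  have hsmooth : ContDiff ℝ 1 F := by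
    simp only [hF, lyapunov_ofFirstHalf hk]
    exact contDiff_eval_derivative_evenPoly.comp
      ((contDiff_coeffMap.comp contDiff_fst).prodMk contDiff_snd)
  have hstrict := hsmooth.contDiffAt.hasStrictFDerivAt (x := (x, t)) one_ne_zero
  -- The partial derivative in $t$ is $\Delta''(t)$, nonzero by `critical_value`.
  have hinv : (fderiv ℝ F (x, t) ∘L .inr ℝ (Fin k → ℝ) ℝ).IsInvertible := by
    refine isInvertible_of_apply_one_ne_zero ?_
    have h1 : HasFDerivAt (fun s : ℝ => F (x, s))
        (fderiv ℝ F (x, t) ∘L .inr ℝ (Fin k → ℝ) ℝ) t :=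
      hstrict.hasFDerivAt.comp t (hasFDerivAt_prodMk_right x t)
    have h2 := (derivative (lyapunov (ofFirstHalf x))).hasDerivAt t
    rw [h1.hasDerivAt.unique h2]
    rcases (isDiscriminant_lyapunov (ofFirstHalf x) hk).critical_value ht with h | h
    · exact h.2.ne
    · exact h.2.ne'
  refine ⟨hstrict.implicitFunctionOfProdDomain hinv,
    (hstrict.hasStrictFDerivAt_implicitFunctionOfProdDomain hinv).hasFDerivAt.differentiableAt,
    (hstrict.eventually_apply_eq_iff_implicitFunctionOfProdDomain hinv).self_of_nhds.1 rfl, ?_⟩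
  filter_upwards [hstrict.eventually_apply_implicitFunctionOfProdDomain hinv] with y hy
  simp only [hF] at hy
  rw [hy]
  exact ht

/-- At a closed gap the derivative of the corresponding value of `Δ` vanishes. -/
theorem valueDeriv_eq_zero {k : ℕ} (hk : 1 ≤ k) {x : Fin k → ℝ} {t : ℝ}
    (ht : (derivative (lyapunov (ofFirstHalf x))).eval t = 0)
    (ht2 : |(lyapunov (ofFirstHalf x)).eval t| ≤ 2) : valueDeriv x t = 0 := by
  set a := (lyapunov (ofFirstHalf x)).eval t with ha
  let A : (Fin k → ℝ) → ℝ := fun y => (lyapunov (ofFirstHalf y)).eval t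
  let B : (Fin k → ℝ) → ℝ := fun y => (derivative (lyapunov (ofFirstHalf y))).eval t
  let D : (Fin k → ℝ) → ℝ := fun y => (derivative (derivative (lyapunov (ofFirstHalf y)))).eval t
  have hA : HasFDerivAt A (valueDeriv x t) x := by
    have := hasFDerivAt_eval_lyapunov hk (hasFDerivAt_const t x)
    simpa using this
  have hB : DifferentiableAt ℝ B x := by
    simp only [B, lyapunov_ofFirstHalf hk]
    refine ((contDiff_eval_derivative_evenPoly (N := 1)).comp
      (contDiff_coeffMap.prodMk contDiff_const)).differentiable one_ne_zero x
  have hD : DifferentiableAt ℝ D x := by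
    have h : ∀ y, D y = (derivative (derivative (X ^ (2 * k) : ℝ[X]))).eval t +
        ∑ j : Fin k, coeffMap k y j *
          (derivative (derivative (X ^ (2 * (k - 1 - (j : ℕ))) : ℝ[X]))).eval t := by
      intro y
      simp only [D, lyapunov_ofFirstHalf hk, evenPoly, derivative_add, derivative_sum,
        derivative_C_mul, eval_add, eval_finsetSum, eval_C_mul]
    simp only [funext h]
    have hΦ : ∀ j, DifferentiableAt ℝ (fun y => coeffMap k y j) x :=
      differentiableAt_pi.1 (hasFDerivAt_coeffMap x).differentiableAt
    fun_prop
  -- The Laguerre expression of $\Delta(\cdot,y)-a$ at the fixed point $t$. It is nonnegative for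
  -- every $y$, as $|a|\le 2$ makes $\Delta(\cdot,y)-a$ split, and zero at $y=x$. As $B$ and $A-a$
  -- vanish at $x$, its derivative there is $-\Delta''(t)\,dA$.
  let g : (Fin k → ℝ) → ℝ := fun y => B y ^ 2 - (A y - a) * D y
  have hmin : IsLocalMin g x := by
    refine Filter.Eventually.of_forall fun y => ?_
    have h1 : g x = 0 := by simp [g, A, B, ht, ha]
    rw [h1]
    have h2 := laguerre_nonneg (splits_lyapunov_sub (ofFirstHalf y) hk ht2) t
    simpa [g, A, B, D] using h2
  have hg := ((hB.hasFDerivAt.pow 2).sub ((hA.sub_const a).mul hD.hasFDerivAt))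
  have hzero := hmin.hasFDerivAt_eq_zero hg
  have hDne : D x ≠ 0 := by
    rcases (isDiscriminant_lyapunov (ofFirstHalf x) hk).critical_value ht with h | h
    · exact h.2.ne
    · exact h.2.ne'
  ext v
  have h := DFunLike.congr_fun hzero v
  have hBx : B x = 0 := ht
  have hAx : A x - a = 0 := sub_self _
  simp [hBx, hAx] at h
  simpa [hDne] using h

/-- The relation $\sum_j t^{2(k-1-j)}\,d\Phi_j=0$ is nontrivial even for $t=0$, because its last
coefficient is $t^0=1$; hence the last basis vector is not in the range. -/
theorem det_fderiv_coeffMap_eq_zero {k : ℕ} (hk : 1 ≤ k) {x : Fin k → ℝ} {t : ℝ}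
    (ht : (derivative (lyapunov (ofFirstHalf x))).eval t = 0)
    (ht2 : |(lyapunov (ofFirstHalf x)).eval t| ≤ 2) : (fderiv ℝ (coeffMap k) x).det = 0 := by
  by_contra hdet
  have hs : Function.Surjective (fderiv ℝ (coeffMap k) x) :=
    (LinearMap.equivOfDetNeZero (fderiv ℝ (coeffMap k) x : (Fin k → ℝ) →ₗ[ℝ] (Fin k → ℝ))
      hdet).surjective
  obtain ⟨v, hv⟩ := hs (Pi.single ⟨k - 1, by omega⟩ 1)
  have h := DFunLike.congr_fun (valueDeriv_eq_zero hk ht ht2) v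
  rw [valueDeriv_apply, hv, Finset.sum_eq_single ⟨k - 1, by omega⟩] at h
  · simp at h
  · intro j _ hj
    rw [Pi.single_eq_of_ne hj, zero_mul]
  · simp

/-! ### The height map -/

section Height

variable {k : ℕ} {x : Fin k → ℝ} {d : Fin (2 * k - 1) → ℝ}

/-- As $\Delta'$ is odd, the negated and reversed list is another increasing enumeration of the
critical points; both equal `critPoint`. -/
theorem critical_points_symmetric (hk : 1 ≤ k) (hd : StrictMono d)
    (hd0 : ∀ i, (derivative (lyapunov (ofFirstHalf x))).eval (d i) = 0) (i : Fin (2 * k - 1)) :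
    d (Fin.rev i) = -d i := by
  have hP := isDiscriminant_lyapunov (ofFirstHalf x) hk
  have hd' : StrictMono fun i => -d (Fin.rev i) := fun i j hij =>
    neg_lt_neg (hd (Fin.rev_lt_rev.2 hij))
  have hodd : ∀ t, (derivative (lyapunov (ofFirstHalf x))).eval (-t) =
      -(derivative (lyapunov (ofFirstHalf x))).eval t := by
    intro t
    have h := congrArg (fun f => (derivative f).eval t) (lyapunov_comp_neg (ofFirstHalf_mem x))
    simp only [derivative_comp, eval_mul, eval_comp, derivative_neg, derivative_X, eval_neg,
      eval_X, eval_one] at h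
    linarith
  have h1 := critPoint_eq hP hd hd0 i
  rw [critPoint_eq hP hd' (fun i => by rw [hodd, hd0, neg_zero]) i] at h1
  linarith

/-- The first half of a family indexed by the gaps. -/
def firstGaps (d : Fin (2 * k - 1) → ℝ) : Fin k → ℝ := fun j => d ⟨j, by omega⟩

/-- By symmetry the first $k$ critical points are nonpositive, so squaring keeps them distinct. -/
theorem injective_sq_firstGaps (hk : 1 ≤ k) (hd : StrictMono d)
    (hd0 : ∀ i, (derivative (lyapunov (ofFirstHalf x))).eval (d i) = 0) :
    Function.Injective fun j => firstGaps d j ^ 2 := by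
  have hneg : ∀ j, firstGaps d j ≤ 0 := by
    intro j
    have h1 := critical_points_symmetric hk hd hd0 ⟨j, by omega⟩
    have h2 : d ⟨j, by omega⟩ ≤ d (Fin.rev ⟨j, by omega⟩) := hd.monotone (by
      rw [← Fin.val_fin_le, Fin.val_rev]
      simp only
      omega)
    rw [h1] at h2
    change d ⟨j, by omega⟩ ≤ 0
    linarith
  intro i j hij
  have h : firstGaps d i = firstGaps d j := by
    rcases sq_eq_sq_iff_eq_or_eq_neg.1 hij with h | h
    · exact h
    · linarith [hneg i, hneg j]
  have := hd.injective h
  exact Fin.ext (by simpa using this)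

theorem height_eq {q : Fin (2 * k) → ℝ} (hP : IsDiscriminant (lyapunov q) (2 * k))
    (hd : StrictMono d) (hd0 : ∀ i, (derivative (lyapunov q)).eval (d i) = 0)
    (i : Fin (2 * k - 1)) :
    height q (i + 1) = Real.arcosh ((-1) ^ (2 * k - (i + 1)) * (lyapunov q).eval (d i) / 2) := by
  rw [height, critPoint_eq hP hd hd0]

theorem one_le_signed_critical_value {q : Fin (2 * k) → ℝ}
    (hP : IsDiscriminant (lyapunov q) (2 * k)) (hd : StrictMono d)
    (hd0 : ∀ i, (derivative (lyapunov q)).eval (d i) = 0) (i : Fin (2 * k - 1)) :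
    1 ≤ (-1) ^ (2 * k - ((i : ℕ) + 1)) * (lyapunov q).eval (d i) / 2 := by
  have := hP.critical_value_sign hd hd0 i
  rw [Nat.sub_sub, add_comm 1] at this
  linarith

theorem one_lt_signed_critical_value_iff {q : Fin (2 * k) → ℝ}
    (hP : IsDiscriminant (lyapunov q) (2 * k)) (hd : StrictMono d)
    (hd0 : ∀ i, (derivative (lyapunov q)).eval (d i) = 0) (i : Fin (2 * k - 1)) :
    1 < (-1) ^ (2 * k - ((i : ℕ) + 1)) * (lyapunov q).eval (d i) / 2 ↔
      2 < |(lyapunov q).eval (d i)| := by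
  have h := one_le_signed_critical_value hP hd hd0 i
  have h2 : |(lyapunov q).eval (d i)| =
      (-1) ^ (2 * k - ((i : ℕ) + 1)) * (lyapunov q).eval (d i) := by
    rw [← abs_of_nonneg (show 0 ≤ (-1) ^ (2 * k - ((i : ℕ) + 1)) * (lyapunov q).eval (d i) by
      linarith), abs_mul, abs_neg_one_pow, one_mul]
  rw [h2]
  constructor <;> intro h3 <;> linarith

theorem heightMap_nonneg (hk : 1 ≤ k) (y : Fin k → ℝ) (j : Fin k) : 0 ≤ heightMap k y j := by
  have hP := isDiscriminant_lyapunov (ofFirstHalf y) hk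
  obtain ⟨d, hd, hd0⟩ := hP.exists_critical_points
  have h := height_eq hP hd hd0 ⟨j, by omega⟩
  simp only at h
  rw [heightMap, h]
  exact Real.arcosh_nonneg (one_le_signed_critical_value hP hd hd0 ⟨j, by omega⟩)

/-- The implicit-function branches keep their strict order near $x$, so the $i$-th branch remains
the $i$-th critical point. -/
theorem eventually_heightMap_eq (hk : 1 ≤ k) (hd : StrictMono d)
    (hd0 : ∀ i, (derivative (lyapunov (ofFirstHalf x))).eval (d i) = 0) :
    ∃ ψ : Fin (2 * k - 1) → (Fin k → ℝ) → ℝ,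
      (∀ i, DifferentiableAt ℝ (ψ i) x ∧ ψ i x = d i) ∧
      ∀ᶠ y in 𝓝 x, ∀ i : Fin (2 * k - 1), height (ofFirstHalf y) (i + 1) =
        Real.arcosh ((-1) ^ (2 * k - (i + 1)) * (lyapunov (ofFirstHalf y)).eval (ψ i y) / 2) := by
  choose ψ hψ hψx hψ0 using fun i => exists_differentiable_critical_point hk (hd0 i)
  refine ⟨ψ, fun i => ⟨hψ i, hψx i⟩, ?_⟩
  have hmono : ∀ᶠ y in 𝓝 x, StrictMono fun i => ψ i y := by
    have h : ∀ᶠ y in 𝓝 x, ∀ i j : Fin (2 * k - 1), i < j → ψ i y < ψ j y := by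
      refine Filter.eventually_all.2 fun i => Filter.eventually_all.2 fun j =>
        Filter.eventually_imp_distrib_left.2 fun hij => ?_
      refine (hψ i).continuousAt.eventually_lt (hψ j).continuousAt ?_
      rw [hψx, hψx]
      exact hd hij
    exact h.mono fun y hy i j => hy i j
  filter_upwards [hmono, Filter.eventually_all.2 hψ0] with y h1 h2 i
  exact height_eq (isDiscriminant_lyapunov (ofFirstHalf y) hk) h1 h2 i

/-- The diagonal operator with the given entries. -/
noncomputable def diagCLM (c : Fin k → ℝ) : (Fin k → ℝ) →L[ℝ] (Fin k → ℝ) :=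
  LinearMap.toContinuousLinearMap (Matrix.toLin' (Matrix.diagonal c))

theorem diagCLM_apply (c v : Fin k → ℝ) (i : Fin k) : diagCLM c v i = c i * v i := by
  simp [diagCLM, Matrix.mulVec_diagonal]

theorem det_diagCLM (c : Fin k → ℝ) : (diagCLM c).det = ∏ i, c i := by
  rw [diagCLM, LinearMap.det_toContinuousLinearMap, LinearMap.det_toLin', Matrix.det_diagonal]

/-- Where the first `k` gaps are open, the height map is differentiable and its derivative is that
of the coefficient map followed by an isomorphism. -/
theorem exists_hasFDerivAt_heightMap (hk : 1 ≤ k) (hd : StrictMono d)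
    (hd0 : ∀ i, (derivative (lyapunov (ofFirstHalf x))).eval (d i) = 0)
    (hopen : ∀ j : Fin k, 2 < |(lyapunov (ofFirstHalf x)).eval (firstGaps d j)|) :
    ∃ c : Fin k → ℝ, (∀ j, c j ≠ 0) ∧ HasFDerivAt (heightMap k)
      ((diagCLM c).comp ((nodeEval (firstGaps d)).comp (fderiv ℝ (coeffMap k) x))) x := by
  obtain ⟨ψ, hψ, hev⟩ := eventually_heightMap_eq hk hd hd0
  let g : Fin k → Fin (2 * k - 1) := fun j => ⟨j, by omega⟩
  let s : Fin k → ℝ := fun j => (-1) ^ (2 * k - ((j : ℕ) + 1))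
  let a : Fin k → ℝ := fun j => s j * (lyapunov (ofFirstHalf x)).eval (d (g j)) / 2
  have ha : ∀ j, 1 < a j := fun j =>
    (one_lt_signed_critical_value_iff (isDiscriminant_lyapunov _ hk) hd hd0 (g j)).2 (hopen j)
  refine ⟨fun j => (√(a j ^ 2 - 1))⁻¹ * (s j / 2), fun j => ?_, ?_⟩
  · have h1 : 0 < a j ^ 2 - 1 := by nlinarith [ha j]
    have h2 : s j ≠ 0 := pow_ne_zero _ (by norm_num)
    have h3 := Real.sqrt_pos.2 h1
    positivity
  · rw [hasFDerivAt_pi']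
    intro j
    have h1 := hasFDerivAt_eval_lyapunov hk (hψ (g j)).1.hasFDerivAt
    rw [(hψ (g j)).2, hd0, zero_smul, add_zero] at h1
    have h2 : HasFDerivAt (fun y => s j * (lyapunov (ofFirstHalf y)).eval (ψ (g j) y) / 2)
        ((s j / 2) • valueDeriv x (d (g j))) x := by
      have := h1.const_mul (s j / 2)
      refine this.congr_of_eventuallyEq (Filter.Eventually.of_forall fun y => ?_)
      simp only
      ring
    have h3 : s j * (lyapunov (ofFirstHalf x)).eval (ψ (g j) x) / 2 = a j := by
      rw [(hψ (g j)).2]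
    have h4 : HasDerivAt Real.arcosh (√(a j ^ 2 - 1))⁻¹
        (s j * (lyapunov (ofFirstHalf x)).eval (ψ (g j) x) / 2) := by
      rw [h3]
      exact Real.hasDerivAt_arcosh (ha j)
    have h5 := h4.comp_hasFDerivAt x h2
    have h6 : (fun y => heightMap k y j) =ᶠ[𝓝 x]
        Real.arcosh ∘ fun y => s j * (lyapunov (ofFirstHalf y)).eval (ψ (g j) y) / 2 :=
      hev.mono fun y hy => hy (g j)
    refine (h5.congr_of_eventuallyEq h6).congr_fderiv ?_
    ext v
    simp [diagCLM_apply, nodeEval_apply, valueDeriv_apply, firstGaps, g, mul_assoc]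

theorem heightMap_differentiable_iff (hk : 1 ≤ k) (x : Fin k → ℝ) :
    (DifferentiableAt ℝ (heightMap k) x ∧ (fderiv ℝ (heightMap k) x).det ≠ 0) ↔
      (fderiv ℝ (coeffMap k) x).det ≠ 0 := by
  have hP := isDiscriminant_lyapunov (ofFirstHalf x) hk
  obtain ⟨d, hd, hd0⟩ := hP.exists_critical_points
  have hformula : (∀ j : Fin k, 2 < |(lyapunov (ofFirstHalf x)).eval (firstGaps d j)|) →
      DifferentiableAt ℝ (heightMap k) x ∧ ((fderiv ℝ (heightMap k) x).det ≠ 0 ↔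
        (fderiv ℝ (coeffMap k) x).det ≠ 0) := by
    intro hopen
    obtain ⟨c, hc, hder⟩ := exists_hasFDerivAt_heightMap hk hd hd0 hopen
    refine ⟨hder.differentiableAt, ?_⟩
    rw [hder.fderiv, det_comp, det_comp, det_diagCLM]
    have h1 : ∏ i, c i ≠ 0 := Finset.prod_ne_zero_iff.2 fun i _ => hc i
    have h2 := det_nodeEval_ne_zero (injective_sq_firstGaps hk hd hd0)
    simp [h1, h2]
  constructor
  · rintro ⟨hdiff, hdet⟩
    refine ((hformula fun j => ?_).2).1 hdet
    by_contra hj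
    refine hdet (det_eq_zero_of_forall_apply_eq_zero j ?_)
    have hzero : heightMap k x j = 0 := by
      have h := height_eq hP hd hd0 ⟨j, by omega⟩
      simp only at h
      rw [heightMap, h]
      have h1 := one_le_signed_critical_value hP hd hd0 ⟨j, by omega⟩
      have h2 := (one_lt_signed_critical_value_iff hP hd hd0 ⟨j, by omega⟩).not.2 hj
      exact (Real.arcosh_eq_zero_iff h1).2 (le_antisymm (not_lt.1 h2) h1)
    -- A closed gap makes $h_j$ attain its minimum $0$, so a row of the Jacobian would vanish.
    have hmin : IsLocalMin (fun y => heightMap k y j) x :=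
      Filter.Eventually.of_forall fun y => by
        simp only [hzero]
        exact heightMap_nonneg hk y j
    have h := hmin.hasFDerivAt_eq_zero (hasFDerivAt_pi'.1 hdiff.hasFDerivAt j)
    intro v
    exact DFunLike.congr_fun h v
  · intro hdet
    have := hformula fun j => by
      by_contra hj
      exact hdet (det_fderiv_coeffMap_eq_zero hk (hd0 _) (not_lt.1 hj))
    exact ⟨this.1, this.2.2 hdet⟩

theorem gaps_open (hk : 1 ≤ k) (hdet : (fderiv ℝ (coeffMap k) x).det ≠ 0) :
    (∀ n ∈ Finset.Icc 1 k, 0 < height (ofFirstHalf x) n) ∧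
      ∀ n ∈ Finset.Icc 1 (2 * k - 1), gapLeft (ofFirstHalf x) n < gapRight (ofFirstHalf x) n := by
  have hP := isDiscriminant_lyapunov (ofFirstHalf x) hk
  obtain ⟨d, hd, hd0⟩ := hP.exists_critical_points
  have hopen : ∀ i, 2 < |(lyapunov (ofFirstHalf x)).eval (d i)| := fun i => by
    by_contra hj
    exact hdet (det_fderiv_coeffMap_eq_zero hk (hd0 _) (not_lt.1 hj))
  constructor
  · intro n hn
    rw [Finset.mem_Icc] at hn
    obtain ⟨n, rfl⟩ := Nat.exists_eq_add_of_le' hn.1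
    have h := height_eq hP hd hd0 ⟨n, by omega⟩
    simp only at h
    rw [h]
    exact Real.arcosh_pos
      ((one_lt_signed_critical_value_iff hP hd hd0 ⟨n, by omega⟩).2 (hopen _))
  · intro n hn
    rw [Finset.mem_Icc] at hn
    obtain ⟨n, rfl⟩ := Nat.exists_eq_add_of_le' hn.1
    exact gapLeft_lt_gapRight hP hd hd0 ⟨n, by omega⟩ (hopen _)

end Height

/-! ### Second order expansion of the Lyapunov function at the zero potential -/

/-- The solution of `y_{n+2} = (t - w_n) y_{n+1} - y_n - f_n` with `y_0 = a`, `y_1 = b`. -/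
def forcedSol (t : ℝ) (w f : ℕ → ℝ) (a b : ℝ) : ℕ → ℝ
  | 0 => a
  | 1 => b
  | n + 2 => (t - w n) * forcedSol t w f a b (n + 1) - forcedSol t w f a b n - f n

theorem forcedSol_add_two (t : ℝ) (w f : ℕ → ℝ) (a b : ℝ) (n : ℕ) :
    forcedSol t w f a b (n + 2) =
      (t - w n) * forcedSol t w f a b (n + 1) - forcedSol t w f a b n - f n := rfl

theorem contDiff_forcedSol {E : Type*} [NormedAddCommGroup E] [NormedSpace ℝ E]
    {N : WithTop ℕ∞} (t : ℝ) {w f : E → ℕ → ℝ} (hw : ∀ n, ContDiff ℝ N fun e => w e n)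
    (hf : ∀ n, ContDiff ℝ N fun e => f e n) (a b : ℝ) (n : ℕ) :
    ContDiff ℝ N fun e => forcedSol t (w e) (f e) a b n := by
  have h : ∀ n, (ContDiff ℝ N fun e => forcedSol t (w e) (f e) a b n) ∧
      ContDiff ℝ N fun e => forcedSol t (w e) (f e) a b (n + 1) := by
    intro n
    induction n with
    | zero => exact ⟨contDiff_const, contDiff_const⟩
    | succ n ih =>
      refine ⟨ih.2, ?_⟩
      simp only [forcedSol_add_two]
      exact (((contDiff_const.sub (hw n)).mul ih.2).sub ih.1).sub (hf n)
  exact (h n).1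

/-- Variation of constants. -/
theorem forcedSol_eq_sum (t : ℝ) (f : ℕ → ℝ) (n : ℕ) :
    forcedSol t 0 f 0 0 (n + 1) =
      -∑ i ∈ Finset.range n, forcedSol t 0 0 0 1 (n - i) * f i := by
  have h : ∀ n, forcedSol t 0 f 0 0 (n + 1) =
      -∑ i ∈ Finset.range n, forcedSol t 0 0 0 1 (n - i) * f i ∧
      forcedSol t 0 f 0 0 (n + 2) =
      -∑ i ∈ Finset.range (n + 1), forcedSol t 0 0 0 1 (n + 1 - i) * f i := by
    intro n
    induction n with
    | zero => simp [forcedSol]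
    | succ n ih =>
      refine ⟨ih.2, ?_⟩
      rw [forcedSol_add_two, ih.1, ih.2, Finset.sum_range_succ _ (n + 1),
        Finset.sum_range_succ _ n, Finset.sum_range_succ _ n]
      have h1 : ∑ i ∈ Finset.range n, forcedSol t 0 0 0 1 (n + 1 + 1 - i) * f i =
          t * ∑ i ∈ Finset.range n, forcedSol t 0 0 0 1 (n + 1 - i) * f i -
            ∑ i ∈ Finset.range n, forcedSol t 0 0 0 1 (n - i) * f i := by
        rw [Finset.mul_sum, ← Finset.sum_sub_distrib]
        refine Finset.sum_congr rfl fun i hi => ?_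
        rw [Finset.mem_range] at hi
        rw [show n + 1 + 1 - i = n - i + 2 by omega, show n + 1 - i = n - i + 1 by omega,
          forcedSol_add_two]
        simp only [Pi.zero_apply]
        ring
      rw [h1, show n + 1 + 1 - n = 2 by omega, show n + 1 + 1 - (n + 1) = 1 by omega,
        show n + 1 - n = 1 by omega]
      simp [forcedSol]
      ring
  exact (h n).1

/-- The values of an odd potential at the sites `1, 2, …`. -/
noncomputable def siteValue {k : ℕ} (x : Fin k → ℝ) (n : ℕ) : ℝ :=
  periodicExt (ofFirstHalf x) (n + 1 : ℕ)

theorem ofFirstHalf_smul {k : ℕ} (s : ℝ) (x : Fin k → ℝ) :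
    ofFirstHalf (s • x) = s • ofFirstHalf x := by
  ext i
  simp only [ofFirstHalf, Pi.smul_apply]
  split_ifs <;> simp

theorem siteValue_smul {k : ℕ} (s : ℝ) (x : Fin k → ℝ) (n : ℕ) :
    siteValue (s • x) n = s * siteValue x n := by
  rw [siteValue, siteValue, ofFirstHalf_smul, periodicExt, periodicExt]
  split_ifs <;> simp

theorem siteValue_fin {k : ℕ} (x : Fin k → ℝ) (i : Fin (2 * k)) :
    siteValue x i = ofFirstHalf x i := periodicExt_natCast_succ _ i

/-- The first order term of a solution in powers of the potential. -/
noncomputable def firstOrder {k : ℕ} (t a b : ℝ) (x : Fin k → ℝ) : ℕ → ℝ :=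
  forcedSol t 0 (fun i => siteValue x i * forcedSol t 0 0 a b (i + 1)) 0 0

/-- The remainder of second order of a solution for the potential `s x`, divided by `s²`. -/
noncomputable def secondOrder {k : ℕ} (t a b s : ℝ) (x : Fin k → ℝ) : ℕ → ℝ :=
  forcedSol t (fun i => s * siteValue x i) (fun i => siteValue x i * firstOrder t a b x (i + 1)) 0 0

theorem eval_fundSol_smul {k : ℕ} (t a b s : ℝ) (x : Fin k → ℝ) (n : ℕ) :
    (fundSol (ofFirstHalf (s • x)) (C a) (C b) n).eval t =
      forcedSol t 0 0 a b n + s * firstOrder t a b x n + s ^ 2 * secondOrder t a b s x n := by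
  have h : ∀ n, (fundSol (ofFirstHalf (s • x)) (C a) (C b) n).eval t =
      forcedSol t 0 0 a b n + s * firstOrder t a b x n + s ^ 2 * secondOrder t a b s x n ∧
      (fundSol (ofFirstHalf (s • x)) (C a) (C b) (n + 1)).eval t =
      forcedSol t 0 0 a b (n + 1) + s * firstOrder t a b x (n + 1) +
        s ^ 2 * secondOrder t a b s x (n + 1) := by
    intro n
    induction n with
    | zero => simp [fundSol, forcedSol, firstOrder, secondOrder]
    | succ n ih =>
      refine ⟨ih.2, ?_⟩
      have hv : periodicExt (ofFirstHalf (s • x)) ((n + 1 : ℕ) : ℤ) = s * siteValue x n :=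
        siteValue_smul s x n
      have h1 : firstOrder t a b x (n + 1 + 1) = (t - 0) * firstOrder t a b x (n + 1) -
        firstOrder t a b x n - siteValue x n * forcedSol t 0 0 a b (n + 1) := rfl
      have h2 : secondOrder t a b s x (n + 1 + 1) =
        (t - s * siteValue x n) * secondOrder t a b s x (n + 1) -
        secondOrder t a b s x n - siteValue x n * firstOrder t a b x (n + 1) := rfl
      rw [fundSol_add_two, eval_sub, eval_mul, ih.1, ih.2, hv, h1, h2, forcedSol_add_two]
      simp only [eval_sub, eval_X, eval_C, Pi.zero_apply]
      ring
  exact (h n).1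

/-! ### The expansion at the closed gaps of the zero potential -/

/-- The angles `m π / (2k)`, `1 ≤ m ≤ k`. -/
noncomputable def nodeAngle {k : ℕ} (m : Fin k) : ℝ := ((m : ℕ) + 1 : ℕ) * Real.pi / (2 * k)

/-- The nonnegative closed gaps `2 cos (m π / (2k))` of the zero potential. -/
noncomputable def node {k : ℕ} (m : Fin k) : ℝ := 2 * Real.cos (nodeAngle m)

section Node

variable {k : ℕ}

theorem nodeAngle_pos (m : Fin k) : 0 < nodeAngle m := by
  have hk : 0 < k := by have := m.isLt; omega
  unfold nodeAngle
  positivity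

theorem nodeAngle_le (m : Fin k) : nodeAngle m ≤ Real.pi / 2 := by
  have hm := m.isLt
  have hk : (0 : ℝ) < k := by exact_mod_cast (by omega : 0 < k)
  have hmk : (((m : ℕ) + 1 : ℕ) : ℝ) ≤ k := by exact_mod_cast hm
  unfold nodeAngle
  rw [div_le_div_iff₀ (by positivity) (by norm_num)]
  nlinarith [Real.pi_pos]

theorem sin_nodeAngle_pos (m : Fin k) : 0 < Real.sin (nodeAngle m) :=
  Real.sin_pos_of_pos_of_lt_pi (nodeAngle_pos m) (by linarith [nodeAngle_le m, Real.pi_pos])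

theorem two_mul_nodeAngle (m : Fin k) :
    ((2 * k : ℕ) : ℝ) * nodeAngle m = ((m : ℕ) + 1 : ℕ) * Real.pi := by
  have hk : (k : ℝ) ≠ 0 := by
    have := m.isLt
    exact_mod_cast (by omega : k ≠ 0)
  unfold nodeAngle
  push_cast
  field_simp

theorem injective_node_sq : Function.Injective fun m : Fin k => node m ^ 2 := by
  intro m l h
  have hpos : ∀ m : Fin k, 0 ≤ node m := fun m =>
    mul_nonneg zero_le_two (Real.cos_nonneg_of_neg_pi_div_two_le_of_le
      (by linarith [nodeAngle_pos m, Real.pi_pos]) (nodeAngle_le m))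
  have h1 : node m = node l := (sq_eq_sq₀ (hpos m) (hpos l)).1 h
  have h2 : Real.cos (nodeAngle m) = Real.cos (nodeAngle l) := by
    unfold node at h1
    linarith
  have hmem : ∀ m : Fin k, nodeAngle m ∈ Set.Icc 0 Real.pi := fun m =>
    ⟨(nodeAngle_pos m).le, by linarith [nodeAngle_le m, Real.pi_pos]⟩
  have h3 := Real.injOn_cos (hmem m) (hmem l) h2
  have h4 := two_mul_nodeAngle m
  rw [h3, two_mul_nodeAngle l] at h4
  have h5 := mul_right_cancel₀ Real.pi_ne_zero h4
  have h6 : (l : ℕ) + 1 = m + 1 := by exact_mod_cast h5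
  exact Fin.ext (by omega)

theorem forcedSol_zero_one_mul_sin (θ : ℝ) (n : ℕ) :
    forcedSol (2 * Real.cos θ) 0 0 0 1 n * Real.sin θ = Real.sin (n * θ) := by
  have h : ∀ n : ℕ, forcedSol (2 * Real.cos θ) 0 0 0 1 n * Real.sin θ = Real.sin (n * θ) ∧
      forcedSol (2 * Real.cos θ) 0 0 0 1 (n + 1) * Real.sin θ = Real.sin ((n + 1 : ℕ) * θ) := by
    intro n
    induction n with
    | zero => simp [forcedSol]
    | succ n ih =>
      refine ⟨ih.2, ?_⟩
      rw [forcedSol_add_two]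
      have e1 : ((n + 1 + 1 : ℕ) : ℝ) * θ = (n + 1 : ℕ) * θ + θ := by push_cast; ring
      have e2 : (n : ℝ) * θ = (n + 1 : ℕ) * θ - θ := by push_cast; ring
      have h1 := ih.1
      rw [e2, Real.sin_sub] at h1
      rw [e1, Real.sin_add]
      simp only [Pi.zero_apply]
      linear_combination 2 * Real.cos θ * ih.2 - h1
  exact (h n).1

theorem forcedSol_zero_one {θ : ℝ} (hθ : Real.sin θ ≠ 0) (n : ℕ) :
    forcedSol (2 * Real.cos θ) 0 0 0 1 n = Real.sin (n * θ) / Real.sin θ := by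
  rw [eq_div_iff hθ, forcedSol_zero_one_mul_sin]

theorem forcedSol_one_zero_succ (t : ℝ) (n : ℕ) :
    forcedSol t 0 0 1 0 (n + 1) = -forcedSol t 0 0 0 1 n := by
  have h : ∀ n : ℕ, forcedSol t 0 0 1 0 (n + 1) = -forcedSol t 0 0 0 1 n ∧
      forcedSol t 0 0 1 0 (n + 2) = -forcedSol t 0 0 0 1 (n + 1) := by
    intro n
    induction n with
    | zero => simp [forcedSol]
    | succ n ih =>
      refine ⟨ih.2, ?_⟩
      rw [forcedSol_add_two t 0 0 1 0 (n + 1), forcedSol_add_two t 0 0 0 1 n, ih.1, ih.2]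
      simp only [Pi.zero_apply]
      ring
  exact (h n).1

/-- Variation of constants for a trace: `U_{p-i} U_{i+1} - U_{p-1-i} U_i = U_p`. -/
theorem forcedSol_product (t : ℝ) (a b : ℕ) :
    forcedSol t 0 0 0 1 (a + 1) * forcedSol t 0 0 0 1 (b + 1) -
      forcedSol t 0 0 0 1 a * forcedSol t 0 0 0 1 b = forcedSol t 0 0 0 1 (a + b + 1) := by
  induction b generalizing a with
  | zero => simp [forcedSol]
  | succ b ih =>
    have h := ih (a + 1)
    rw [show a + (b + 1) + 1 = a + 1 + b + 1 by ring, ← h, forcedSol_add_two _ _ _ _ _ b,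
      forcedSol_add_two _ _ _ _ _ a]
    simp only [Pi.zero_apply]
    ring

theorem sum_firstOrder_trace (t : ℝ) (p : ℕ) (g h : ℕ → ℝ) :
    forcedSol t 0 g 0 0 (p + 1) + forcedSol t 0 h 0 0 p =
      -∑ j ∈ Finset.range p,
        (forcedSol t 0 0 0 1 (p - j) * g j + forcedSol t 0 0 0 1 (p - 1 - j) * h j) := by
  rw [forcedSol_eq_sum, Finset.sum_add_distrib, neg_add]
  congr 1
  cases p with
  | zero => simp [forcedSol]
  | succ p =>
    rw [forcedSol_eq_sum, Finset.sum_range_succ]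
    simp [forcedSol]

/-- By `forcedSol_product` every site enters with the same weight, so the linear term depends on
$\sum q_n$ only and vanishes for odd potentials. -/
theorem firstOrder_trace (t : ℝ) (x : Fin k → ℝ) (p : ℕ) :
    firstOrder t 0 1 x (p + 1) + firstOrder t 1 0 x p =
      -(forcedSol t 0 0 0 1 p * ∑ i ∈ Finset.range p, siteValue x i) := by
  rw [firstOrder, firstOrder, sum_firstOrder_trace, Finset.mul_sum]
  congr 1
  refine Finset.sum_congr rfl fun i hi => ?_
  rw [Finset.mem_range] at hi
  have h := forcedSol_product t (p - 1 - i) i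
  rw [show p - 1 - i + 1 = p - i by omega, show p - 1 - i + i + 1 = p by omega] at h
  rw [forcedSol_one_zero_succ, ← h]
  ring

/-- The same product formula collapses the kernel to a function of the distance $j-i$. -/
theorem secondOrder_trace (t : ℝ) (x : Fin k → ℝ) (p : ℕ) :
    secondOrder t 0 1 0 x (p + 1) + secondOrder t 1 0 0 x p =
      ∑ j ∈ Finset.range p, ∑ i ∈ Finset.range j, siteValue x j * siteValue x i *
        (forcedSol t 0 0 0 1 (j - i) * forcedSol t 0 0 0 1 (p - (j - i))) := by
  have hw : (fun i => (0 : ℝ) * siteValue x i) = 0 := by ext i; simp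
  rw [secondOrder, secondOrder, hw, sum_firstOrder_trace, ← Finset.sum_neg_distrib]
  refine Finset.sum_congr rfl fun j hj => ?_
  rw [Finset.mem_range] at hj
  rw [firstOrder, firstOrder, forcedSol_eq_sum, forcedSol_eq_sum]
  simp only [mul_neg, neg_add, neg_neg, Finset.mul_sum, ← Finset.sum_add_distrib]
  refine Finset.sum_congr rfl fun i hi => ?_
  rw [Finset.mem_range] at hi
  have h := forcedSol_product t (p - 1 - j) i
  rw [show p - 1 - j + 1 = p - j by omega, show p - 1 - j + i + 1 = p - (j - i) by omega] at h
  rw [forcedSol_one_zero_succ, ← h]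
  ring

/-- Writing $\sin^2$ through the cosine of the doubled angle, $2(j-i)=(2j+1)-(2i+1)$ separates the
variables; the diagonal terms cancel because $\cos^2+\sin^2=1$. -/
theorem sum_sum_sin_sq (V : ℕ → ℝ) (θ : ℝ) (n : ℕ) :
    ∑ j ∈ Finset.range n, ∑ i ∈ Finset.range j, V j * V i * Real.sin ((j - i) * θ) ^ 2 =
      ((∑ i ∈ Finset.range n, V i) ^ 2 -
        (∑ i ∈ Finset.range n, V i * Real.cos ((2 * i + 1) * θ)) ^ 2 -
        (∑ i ∈ Finset.range n, V i * Real.sin ((2 * i + 1) * θ)) ^ 2) / 4 := by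
  induction n with
  | zero => simp
  | succ n ih =>
    rw [Finset.sum_range_succ, ih, Finset.sum_range_succ, Finset.sum_range_succ,
      Finset.sum_range_succ]
    have h : ∑ i ∈ Finset.range n, V n * V i * Real.sin ((n - i) * θ) ^ 2 =
        V n * (∑ i ∈ Finset.range n, V i -
          Real.cos ((2 * n + 1) * θ) * ∑ i ∈ Finset.range n, V i * Real.cos ((2 * i + 1) * θ) -
          Real.sin ((2 * n + 1) * θ) *
            ∑ i ∈ Finset.range n, V i * Real.sin ((2 * i + 1) * θ)) / 2 := by
      rw [Finset.mul_sum, Finset.mul_sum, ← Finset.sum_sub_distrib, ← Finset.sum_sub_distrib,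
        Finset.mul_sum, Finset.sum_div]
      refine Finset.sum_congr rfl fun i _ => ?_
      have h1 : Real.cos (2 * ((n - i) * θ)) =
          Real.cos ((2 * n + 1) * θ) * Real.cos ((2 * i + 1) * θ) +
          Real.sin ((2 * n + 1) * θ) * Real.sin ((2 * i + 1) * θ) := by
        rw [← Real.cos_sub]
        congr 1
        ring
      rw [Real.cos_two_mul, Real.cos_sq'] at h1
      linear_combination (-(V n * V i) / 2) * h1
    rw [h]
    have h2 := Real.sin_sq_add_cos_sq ((2 * (n : ℝ) + 1) * θ)
    linear_combination (V n ^ 2 / 4) * h2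

/-- The unnormalized sine coordinates of an odd potential. -/
noncomputable def sineSum (x : Fin k → ℝ) (m : Fin k) : ℝ :=
  ∑ i, ofFirstHalf x i * Real.sin ((2 * (i : ℕ) + 1) * nodeAngle m)

theorem sum_range_siteValue_mul (x : Fin k → ℝ) (g : ℕ → ℝ) :
    ∑ i ∈ Finset.range (2 * k), siteValue x i * g i = ∑ i : Fin (2 * k), ofFirstHalf x i * g i := by
  rw [Finset.sum_range]
  simp only [siteValue_fin]

theorem sum_range_siteValue (x : Fin k → ℝ) : ∑ i ∈ Finset.range (2 * k), siteValue x i = 0 := by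
  have := sum_range_siteValue_mul x fun _ => 1
  simp only [mul_one] at this
  rw [this, sum_oddPotential (ofFirstHalf_mem x)]

/-- Under reversal of the sites the cosine vector is even and the potential odd. -/
theorem sum_mul_cos_eq_zero (x : Fin k → ℝ) (m : Fin k) :
    ∑ i, ofFirstHalf x i * Real.cos ((2 * (i : ℕ) + 1) * nodeAngle m) = 0 := by
  set S := ∑ i, ofFirstHalf x i * Real.cos ((2 * (i : ℕ) + 1) * nodeAngle m) with hS
  have h : S = -S := by
    conv_lhs => rw [hS, ← Equiv.sum_comp Fin.revPerm]
    rw [hS, ← Finset.sum_neg_distrib]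
    refine Finset.sum_congr rfl fun i _ => ?_
    have hi : ((Fin.rev i : ℕ) : ℝ) = (2 * k : ℕ) - 1 - (i : ℕ) := by
      have hi' := i.isLt
      rw [Fin.val_rev, Nat.cast_sub (by omega)]
      push_cast
      ring
    have harg : (2 * ((Fin.rev i : ℕ) : ℝ) + 1) * nodeAngle m =
        ((m : ℕ) + 1 : ℕ) * (2 * Real.pi) - (2 * (i : ℕ) + 1) * nodeAngle m := by
      rw [hi]
      linear_combination 2 * two_mul_nodeAngle m
    rw [Fin.revPerm_apply, harg, Real.cos_nat_mul_two_pi_sub, ofFirstHalf_mem x i]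
    ring
  linarith

/-- The second order term of `Δ` at the `m`-th node for the potential `s x`, divided by `s²`. -/
noncomputable def secondOrderMap (k : ℕ) (p : ℝ × (Fin k → ℝ)) : Fin k → ℝ := fun m =>
  secondOrder (node m) 0 1 p.1 p.2 (2 * k + 1) + secondOrder (node m) 1 0 p.1 p.2 (2 * k)

theorem contDiff_secondOrderMap {N : WithTop ℕ∞} : ContDiff ℝ N (secondOrderMap k) := by
  refine contDiff_pi.2 fun m => ?_
  have hv : ∀ n, ContDiff ℝ N fun p : ℝ × (Fin k → ℝ) => siteValue p.2 n := fun n =>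
    (contDiff_periodicExt_ofFirstHalf _).comp contDiff_snd
  have h1 : ∀ a b n, ContDiff ℝ N fun p : ℝ × (Fin k → ℝ) => firstOrder (node m) a b p.2 n :=
    fun a b n => contDiff_forcedSol _ (fun _ => contDiff_const)
      (fun i => (hv i).mul contDiff_const) 0 0 n
  have h2 : ∀ a b n, ContDiff ℝ N fun p : ℝ × (Fin k → ℝ) =>
      secondOrder (node m) a b p.1 p.2 n :=
    fun a b n => contDiff_forcedSol _ (fun i => contDiff_fst.mul (hv i))
      (fun i => (hv i).mul (h1 a b (i + 1))) 0 0 n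
  exact (h2 _ _ _).add (h2 _ _ _)

/-- The coefficients of the quadratic part of `Δ` at the nodes. -/
noncomputable def quadCoeff (m : Fin k) : ℝ :=
  (-1) ^ ((m : ℕ) + 1) / (4 * Real.sin (nodeAngle m) ^ 2)

theorem quadCoeff_ne_zero (m : Fin k) : quadCoeff m ≠ 0 := by
  have := sin_nodeAngle_pos m
  exact div_ne_zero (pow_ne_zero _ (by norm_num)) (by positivity)

/-- At a node $2k\theta$ is a multiple of $\pi$, so the two factors of the kernel agree up to sign
and it becomes a multiple of $\sin^2((j-i)\theta)$. Of the three squares in `sum_sum_sin_sq`,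
oddness kills the total and the cosine sum. -/
theorem secondOrderMap_zero (x : Fin k → ℝ) (m : Fin k) :
    secondOrderMap k (0, x) m = quadCoeff m * sineSum x m ^ 2 := by
  have hsin := (sin_nodeAngle_pos m).ne'
  have h1 : secondOrderMap k (0, x) m = -(-1) ^ ((m : ℕ) + 1) / Real.sin (nodeAngle m) ^ 2 *
      ∑ j ∈ Finset.range (2 * k), ∑ i ∈ Finset.range j,
        siteValue x j * siteValue x i * Real.sin ((j - i) * nodeAngle m) ^ 2 := by
    simp only [secondOrderMap]
    rw [secondOrder_trace, Finset.mul_sum]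
    refine Finset.sum_congr rfl fun j hj => ?_
    rw [Finset.mul_sum]
    refine Finset.sum_congr rfl fun i hi => ?_
    rw [Finset.mem_range] at hi hj
    rw [node, forcedSol_zero_one hsin, forcedSol_zero_one hsin, Nat.cast_sub (show j - i ≤ 2 * k by omega),
      Nat.cast_sub hi.le, sub_mul ((2 * k : ℕ) : ℝ), two_mul_nodeAngle, Real.sin_nat_mul_pi_sub]
    field_simp
  have hc := sum_range_siteValue_mul x fun i => Real.cos ((2 * (i : ℕ) + 1) * nodeAngle m)
  have hs : ∑ i ∈ Finset.range (2 * k),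
      siteValue x i * Real.sin ((2 * (i : ℕ) + 1) * nodeAngle m) = sineSum x m :=
    sum_range_siteValue_mul x fun i => Real.sin ((2 * (i : ℕ) + 1) * nodeAngle m)
  rw [sum_mul_cos_eq_zero] at hc
  rw [h1, sum_sum_sin_sq, sum_range_siteValue, hc, hs, quadCoeff]
  field_simp
  ring

theorem eval_lyapunov_smul (s : ℝ) (x : Fin k → ℝ) (m : Fin k) :
    (lyapunov (ofFirstHalf (s • x))).eval (node m) =
      forcedSol (node m) 0 0 0 1 (2 * k + 1) + forcedSol (node m) 0 0 1 0 (2 * k) +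
        s ^ 2 * secondOrderMap k (s, x) m := by
  have h1 := eval_fundSol_smul (node m) 0 1 s x (2 * k + 1)
  have h2 := eval_fundSol_smul (node m) 1 0 s x (2 * k)
  have h3 := firstOrder_trace (node m) x (2 * k)
  rw [sum_range_siteValue] at h3
  simp only [map_zero, map_one] at h1 h2
  rw [lyapunov, eval_add, h1, h2, secondOrderMap]
  linear_combination s * h3

/-- An exact identity for all $s$, since `secondOrderMap` contains the whole remainder. Dividing by
$s^2$ desingularizes $\Phi$ at the zero potential. -/
theorem nodeEval_coeffMap_smul (hk : 1 ≤ k) (s : ℝ) (x : Fin k → ℝ) :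
    nodeEval node (coeffMap k (s • x)) =
      nodeEval node (coeffMap k 0) + s ^ 2 • secondOrderMap k (s, x) := by
  ext m
  have h1 := eval_lyapunov_smul s x m
  have h2 := eval_lyapunov_smul 0 x m
  rw [zero_smul] at h2
  rw [lyapunov_ofFirstHalf hk, eval_evenPoly_eq_nodeEval node] at h1 h2
  rw [Pi.add_apply, Pi.smul_apply, smul_eq_mul]
  linear_combination h1 - h2

end Node

/-! ### Counting nondegenerate solutions -/

theorem isInvertible_of_injective {E : Type*} [NormedAddCommGroup E] [NormedSpace ℝ E]
    [FiniteDimensional ℝ E] {f : E →L[ℝ] E} (hf : Function.Injective f) : f.IsInvertible :=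
  ⟨(LinearEquiv.ofInjectiveEndo (f : E →ₗ[ℝ] E) hf).toContinuousLinearEquiv, by ext; rfl⟩

/-- The number of zeros of `F (s, ·)` is constant near a parameter at which they are all
nondegenerate, provided that the zeros stay in a compact set. -/
theorem eventually_ncard_zeros_eq {E : Type*} [NormedAddCommGroup E] [NormedSpace ℝ E]
    [FiniteDimensional ℝ E] {F : ℝ × E → E} (hF : ContDiff ℝ 1 F) {s₀ : ℝ} {A : Finset E}
    {K : Set E} (hK : IsCompact K) (hA : ∀ x, F (s₀, x) = 0 ↔ x ∈ A)
    (hinj : ∀ a ∈ A, Function.Injective (fderiv ℝ F (s₀, a) ∘L .inr ℝ ℝ E))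
    (hconf : ∀ s x, F (s, x) = 0 → x ∈ K) :
    ∀ᶠ s in 𝓝 s₀, {x | F (s, x) = 0}.ncard = A.card := by
  classical
  have : CompleteSpace E := FiniteDimensional.complete ℝ E
  have hψ : ∀ a, ∃ ψ : ℝ → E, a ∈ A → Filter.Tendsto ψ (𝓝 s₀) (𝓝 a) ∧
      (∀ᶠ s in 𝓝 s₀, F (s, ψ s) = 0) ∧ ∀ᶠ p in 𝓝 (s₀, a), F p = 0 → ψ p.1 = p.2 := by
    intro a
    by_cases ha : a ∈ A
    swap
    · exact ⟨0, fun h => absurd h ha⟩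
    have hstrict := hF.contDiffAt.hasStrictFDerivAt (x := (s₀, a)) one_ne_zero
    have hinv := isInvertible_of_injective (hinj a ha)
    have ha0 := (hA a).2 ha
    refine ⟨hstrict.implicitFunctionOfProdDomain hinv, fun _ =>
      ⟨hstrict.tendsto_implicitFunctionOfProdDomain hinv, ?_, ?_⟩⟩
    · filter_upwards [hstrict.eventually_apply_implicitFunctionOfProdDomain hinv] with s hs
      rw [hs, ha0]
    · filter_upwards [hstrict.eventually_apply_eq_iff_implicitFunctionOfProdDomain hinv] with p hp
      rw [ha0] at hp
      exact hp.1
  choose ψ hψ using hψ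
  have h1 : ∀ᶠ s in 𝓝 s₀, ∀ a ∈ A, F (s, ψ a s) = 0 :=
    (Filter.eventually_all_finset A).2 fun a ha => (hψ a ha).2.1
  have h2 : ∀ᶠ s in 𝓝 s₀, ∀ a ∈ A, ∀ b ∈ A, a ≠ b → ψ a s ≠ ψ b s :=
    (Filter.eventually_all_finset A).2 fun a ha => (Filter.eventually_all_finset A).2 fun b hb =>
      Filter.eventually_imp_distrib_left.2 fun hab =>
        (((hψ a ha).1.sub (hψ b hb).1).eventually_ne (sub_ne_zero.2 hab)).mono
          fun s hs => sub_ne_zero.1 hs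
  -- Near a zero at $s_0$ only its own branch survives, near any other point there are no zeros;
  -- compactness of $K$ makes this uniform.
  have h3 : ∀ᶠ s in 𝓝 s₀, ∀ x ∈ K, F (s, x) = 0 → ∃ a ∈ A, ψ a s = x := by
    refine hK.eventually_forall_of_forall_eventually fun x _ => ?_
    by_cases hx : x ∈ A
    · filter_upwards [(hψ x hx).2.2] with p hp h0
      exact ⟨x, hx, hp h0⟩
    · have h0 : F (s₀, x) ≠ 0 := (hA x).not.2 hx
      filter_upwards [hF.continuous.continuousAt.eventually_ne h0] with p hp h0
      exact absurd h0 hp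
  filter_upwards [h1, h2, h3] with s g1 g2 g3
  have hset : {x | F (s, x) = 0} = (A.image fun a => ψ a s : Finset E) := by
    ext x
    simp only [Set.mem_ofPred_eq, Finset.coe_image, Set.mem_image, Finset.mem_coe]
    constructor
    · intro h
      exact g3 x (hconf s x h) h
    · rintro ⟨a, ha, rfl⟩
      exact g1 a ha
  rw [hset, Set.ncard_coe_finset, Finset.card_image_of_injOn]
  intro a ha b hb hab
  by_contra hne
  exact g2 a ha b hb hne hab

/-! ### Isospectral sets of small potentials -/

section Isospectral

variable {k : ℕ}

/-- The squared Euclidean norm of an odd potential. -/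
noncomputable def sqNorm (x : Fin k → ℝ) : ℝ := ∑ i, ofFirstHalf x i ^ 2

theorem sq_apply_le_sqNorm (x : Fin k → ℝ) (j : Fin k) : x j ^ 2 ≤ sqNorm x := by
  have h : x j = ofFirstHalf x ⟨j, by omega⟩ := (congrFun (firstHalf_ofFirstHalf x) j).symm
  rw [h]
  exact Finset.single_le_sum (f := fun i => ofFirstHalf x i ^ 2) (fun i _ => sq_nonneg _)
    (Finset.mem_univ _)

theorem sqNorm_smul (s : ℝ) (x : Fin k → ℝ) : sqNorm (s • x) = s ^ 2 * sqNorm x := by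
  simp only [sqNorm, ofFirstHalf_smul, Pi.smul_apply, smul_eq_mul, mul_pow, Finset.mul_sum]

theorem coeffMap_first (hk : 1 ≤ k) (x : Fin k → ℝ) :
    coeffMap k x ⟨0, hk⟩ = -(2 * k) - sqNorm x / 2 := by
  rw [coeffMap, sqNorm, ← coeff_lyapunov_second hk (ofFirstHalf_mem x)]
  rfl

/-- The norm of a potential is a linear function of the second order terms of `Δ`. -/
theorem exists_sqNorm_eq (hk : 1 ≤ k) :
    ∃ l : (Fin k → ℝ) →L[ℝ] ℝ, ∀ s x, sqNorm x = l (secondOrderMap k (s, x)) := by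
  have hdet := det_nodeEval_ne_zero (injective_node_sq (k := k))
  let e := LinearMap.equivOfDetNeZero (nodeEval (node (k := k)) : (Fin k → ℝ) →ₗ[ℝ] (Fin k → ℝ)) hdet
  have he : ∀ a, e.symm (nodeEval node a) = a := fun a => e.symm_apply_apply a
  let l : (Fin k → ℝ) →L[ℝ] ℝ := LinearMap.toContinuousLinearMap
    ((-2 : ℝ) • (LinearMap.proj (⟨0, hk⟩ : Fin k)).comp (e.symm : (Fin k → ℝ) →ₗ[ℝ] (Fin k → ℝ)))
  have hl : ∀ v, l v = -2 * e.symm v ⟨0, hk⟩ := fun v => rfl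
  refine ⟨l, fun s x => ?_⟩
  have hne : ∀ s : ℝ, s ≠ 0 → sqNorm x = l (secondOrderMap k (s, x)) := by
    intro s hs
    have h1 := nodeEval_coeffMap_smul hk s x
    have h2 := congrArg (fun v => e.symm v ⟨0, hk⟩) h1
    simp only [map_add, map_smul, he, Pi.add_apply, Pi.smul_apply, smul_eq_mul, coeffMap_first,
      sqNorm_smul] at h2
    have h3 : sqNorm (0 : Fin k → ℝ) = 0 := by
      have := sqNorm_smul 0 (0 : Fin k → ℝ)
      simpa using this
    rw [h3] at h2
    rw [hl]
    refine mul_left_cancel₀ (pow_ne_zero 2 hs) ?_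
    linear_combination -2 * h2
  -- The value $s=0$, where nothing can be divided by $s^2$, follows by continuity.
  have hcont : Continuous fun s : ℝ => l (secondOrderMap k (s, x)) :=
    l.continuous.comp ((contDiff_secondOrderMap (N := 0)).continuous.comp (by fun_prop))
  have hconst : Continuous fun _ : ℝ => sqNorm x := continuous_const
  have := Continuous.ext_on (dense_compl_singleton (0 : ℝ)) hconst hcont fun s hs => hne s hs
  exact congrFun this s

theorem sineSum_add (x y : Fin k → ℝ) (m : Fin k) :
    sineSum (x + y) m = sineSum x m + sineSum y m := by
  simp only [sineSum, ← Finset.sum_add_distrib, ← add_mul]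
  refine Finset.sum_congr rfl fun i _ => ?_
  congr 1
  simp only [ofFirstHalf, Pi.add_apply]
  split_ifs <;> ring

theorem sineSum_smul (s : ℝ) (x : Fin k → ℝ) (m : Fin k) :
    sineSum (s • x) m = s * sineSum x m := by
  simp only [sineSum, ofFirstHalf_smul, Pi.smul_apply, smul_eq_mul, Finset.mul_sum, mul_assoc]

/-- The unnormalized sine transform of odd potentials. -/
noncomputable def sineMap (k : ℕ) : (Fin k → ℝ) →L[ℝ] (Fin k → ℝ) :=
  LinearMap.toContinuousLinearMap
    { toFun := sineSum
      map_add' := fun x y => funext fun m => sineSum_add x y m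
      map_smul' := fun s x => funext fun m => sineSum_smul s x m }

theorem sineMap_apply (x : Fin k → ℝ) (m : Fin k) : sineMap k x m = sineSum x m := rfl

/-- If all sine sums vanish then $G(0,x)=0$, and the norm of $x$ is a linear function of $G(0,x)$.
This takes the place of the orthogonality relations of the sine vectors. -/
theorem injective_sineMap (hk : 1 ≤ k) : Function.Injective (sineMap k) := by
  rw [injective_iff_map_eq_zero]
  intro x hx
  obtain ⟨l, hl⟩ := exists_sqNorm_eq hk
  have h0 : secondOrderMap k (0, x) = 0 := by
    ext m
    rw [secondOrderMap_zero, ← sineMap_apply, hx]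
    simp
  have h1 := hl 0 x
  rw [h0, map_zero] at h1
  ext j
  have h2 := sq_apply_le_sqNorm x j
  rw [h1] at h2
  exact pow_eq_zero_iff two_ne_zero |>.1 (le_antisymm h2 (sq_nonneg _))

theorem exists_finset_sineMap_sq (hk : 1 ≤ k) {x : Fin k → ℝ} (hx : ∀ m, sineMap k x m ≠ 0) :
    ∃ A : Finset (Fin k → ℝ), A.card = 2 ^ k ∧
      ∀ y, (∀ m, sineMap k y m ^ 2 = sineMap k x m ^ 2) ↔ y ∈ A := by
  classical
  let e := LinearEquiv.ofInjectiveEndo (sineMap k : (Fin k → ℝ) →ₗ[ℝ] (Fin k → ℝ))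
    (injective_sineMap hk)
  let B : Finset (Fin k → ℝ) := Fintype.piFinset fun m => {sineMap k x m, -sineMap k x m}
  refine ⟨B.map e.symm.toEquiv.toEmbedding, ?_, fun y => ?_⟩
  · rw [Finset.card_map, Fintype.card_piFinset]
    have h : ∀ m, ({sineMap k x m, -sineMap k x m} : Finset ℝ).card = 2 := fun m => by
      refine Finset.card_pair fun h => hx m ?_
      linarith
    simp [h]
  · rw [Finset.mem_map_equiv]
    change _ ↔ sineMap k y ∈ B
    simp only [B, Fintype.mem_piFinset, Finset.mem_insert, Finset.mem_singleton,
      sq_eq_sq_iff_eq_or_eq_neg]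

theorem hasFDerivAt_secondOrderMap_right (s : ℝ) (x : Fin k → ℝ) :
    HasFDerivAt (fun y => secondOrderMap k (s, y))
      (fderiv ℝ (secondOrderMap k) (s, x) ∘L .inr ℝ ℝ (Fin k → ℝ)) x :=
  (((contDiff_secondOrderMap (N := 1)).differentiable one_ne_zero
    (s, x)).hasFDerivAt).comp x (hasFDerivAt_prodMk_right s x)

theorem fderiv_secondOrderMap_zero (x v : Fin k → ℝ) (m : Fin k) :
    (fderiv ℝ (secondOrderMap k) (0, x) ∘L .inr ℝ ℝ (Fin k → ℝ)) v m =
      quadCoeff m * (2 * sineMap k x m * sineMap k v m) := by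
  have h1 := hasFDerivAt_pi'.1 (hasFDerivAt_secondOrderMap_right 0 x) m
  have h2 := ((hasFDerivAt_pi'.1 (sineMap k).hasFDerivAt m).pow 2).const_mul (quadCoeff m) (x := x)
  have h3 : (fun y => secondOrderMap k (0, y) m) =
      fun y => quadCoeff m * sineMap k y m ^ 2 := funext fun y => secondOrderMap_zero y m
  rw [h3] at h1
  have h4 := DFunLike.congr_fun (h1.unique h2) v
  simpa [mul_assoc] using h4

theorem injective_fderiv_secondOrderMap (hk : 1 ≤ k) {x : Fin k → ℝ}
    (hx : ∀ m, sineMap k x m ≠ 0) :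
    Function.Injective (fderiv ℝ (secondOrderMap k) (0, x) ∘L .inr ℝ ℝ (Fin k → ℝ)) := by
  rw [injective_iff_map_eq_zero]
  intro v hv
  refine injective_sineMap hk ?_
  rw [map_zero]
  ext m
  have h := congrFun hv m
  rw [fderiv_secondOrderMap_zero] at h
  simpa [quadCoeff_ne_zero m, hx m] using h

/-- At $s=0$ the solutions are the $2^k$ sign choices for the sine sums, nondegenerate since none of
these vanishes; `exists_sqNorm_eq` keeps all solutions in one ball. -/
theorem eventually_ncard_secondOrderMap_eq (hk : 1 ≤ k) {x : Fin k → ℝ}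
    (hx : ∀ m, sineMap k x m ≠ 0) :
    ∀ᶠ s in 𝓝 (0 : ℝ),
      {y | secondOrderMap k (s, y) = secondOrderMap k (s, x)}.ncard = 2 ^ k := by
  obtain ⟨A, hcard, hA⟩ := exists_finset_sineMap_sq hk hx
  obtain ⟨l, hl⟩ := exists_sqNorm_eq hk
  let F : ℝ × (Fin k → ℝ) → (Fin k → ℝ) :=
    fun p => secondOrderMap k p - secondOrderMap k (p.1, x)
  have hF : ContDiff ℝ 1 F := contDiff_secondOrderMap.sub
    (contDiff_secondOrderMap.comp (contDiff_fst.prodMk contDiff_const))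
  have hFder : ∀ a, fderiv ℝ F (0, a) ∘L .inr ℝ ℝ (Fin k → ℝ) =
      fderiv ℝ (secondOrderMap k) (0, a) ∘L .inr ℝ ℝ (Fin k → ℝ) := by
    intro a
    have h1 := ((hF.differentiable one_ne_zero (0, a)).hasFDerivAt).comp a
      (hasFDerivAt_prodMk_right (0 : ℝ) a)
    have h2 : HasFDerivAt (F ∘ Prod.mk 0) _ a :=
      (hasFDerivAt_secondOrderMap_right 0 a).sub_const (secondOrderMap k (0, x))
    exact h1.unique h2
  have h := eventually_ncard_zeros_eq hF (s₀ := 0) (A := A)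
    (isCompact_closedBall (0 : Fin k → ℝ) (√(sqNorm x))) (fun y => ?_) (fun a ha => ?_)
    fun s y hy => ?_
  · rw [hcard] at h
    simpa only [F, sub_eq_zero] using h
  · rw [← hA, sub_eq_zero, funext_iff]
    refine forall_congr' fun m => ?_
    simp only [secondOrderMap_zero, sineMap_apply]
    exact mul_right_inj' (quadCoeff_ne_zero m)
  · rw [hFder]
    refine injective_fderiv_secondOrderMap hk fun m hm => hx m ?_
    have := (hA a).2 ha m
    rw [hm] at this
    simpa using this.symm
  · rw [mem_closedBall_zero_iff, pi_norm_le_iff_of_nonneg (Real.sqrt_nonneg _)]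
    intro j
    have h1 : sqNorm y = sqNorm x := by
      rw [hl s y, hl s x, sub_eq_zero.1 hy]
    rw [Real.norm_eq_abs]
    refine Real.le_sqrt_of_sq_le ?_
    rw [sq_abs, ← h1]
    exact sq_apply_le_sqNorm y j

/-- Differentiating the identity `nodeEval_coeffMap_smul` in $x$ transfers nondegeneracy of
$G(s,\cdot)$ at $x$ to $\Phi$ at $sx$. -/
theorem det_fderiv_coeffMap_smul_ne_zero (hk : 1 ≤ k) {s : ℝ} (hs : s ≠ 0) {x : Fin k → ℝ}
    (h : (fderiv ℝ (secondOrderMap k) (s, x) ∘L .inr ℝ ℝ (Fin k → ℝ)).det ≠ 0) :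
    (fderiv ℝ (coeffMap k) (s • x)).det ≠ 0 := by
  intro h0
  have h1 : HasFDerivAt (fun y => nodeEval node (coeffMap k (s • y)))
      ((nodeEval node).comp ((fderiv ℝ (coeffMap k) (s • x)).comp
        (s • ContinuousLinearMap.id ℝ (Fin k → ℝ)))) x :=
    (nodeEval node).hasFDerivAt.comp x
      ((hasFDerivAt_coeffMap (s • x)).comp x ((hasFDerivAt_id x).const_smul s))
  have h2 := ((hasFDerivAt_secondOrderMap_right s x).const_smul (s ^ 2)).const_add
    (nodeEval node (coeffMap k 0))
  simp only [nodeEval_coeffMap_smul hk] at h1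
  have h3 := congrArg ContinuousLinearMap.det (h1.unique h2)
  rw [det_comp, det_comp, h0, zero_mul, mul_zero] at h3
  have h4 : (s ^ 2 • (fderiv ℝ (secondOrderMap k) (s, x) ∘L .inr ℝ ℝ (Fin k → ℝ))).det =
      (s ^ 2) ^ k * (fderiv ℝ (secondOrderMap k) (s, x) ∘L .inr ℝ ℝ (Fin k → ℝ)).det := by
    have := LinearMap.det_smul (s ^ 2)
      (fderiv ℝ (secondOrderMap k) (s, x) ∘L .inr ℝ ℝ (Fin k → ℝ) :
        (Fin k → ℝ) →ₗ[ℝ] (Fin k → ℝ))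
    rw [Module.finrank_fin_fun] at this
    exact this
  rw [h4] at h3
  exact mul_ne_zero (pow_ne_zero _ (pow_ne_zero _ hs)) h h3.symm

theorem eventually_det_secondOrderMap_ne_zero (hk : 1 ≤ k) {x : Fin k → ℝ}
    (hx : ∀ m, sineMap k x m ≠ 0) : ∀ᶠ s in 𝓝 (0 : ℝ),
      (fderiv ℝ (secondOrderMap k) (s, x) ∘L .inr ℝ ℝ (Fin k → ℝ)).det ≠ 0 := by
  have hcont : Continuous fun s : ℝ =>
      (fderiv ℝ (secondOrderMap k) (s, x) ∘L .inr ℝ ℝ (Fin k → ℝ)).det := by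
    refine ContinuousLinearMap.continuous_det.comp (Continuous.clm_comp ?_ continuous_const)
    exact ((contDiff_secondOrderMap (N := 1)).continuous_fderiv one_ne_zero).comp (by fun_prop)
  refine hcont.continuousAt.eventually_ne ?_
  have hinj := injective_fderiv_secondOrderMap hk hx
  exact (LinearEquiv.isUnit_det' (LinearEquiv.ofInjectiveEndo
    (fderiv ℝ (secondOrderMap k) (0, x) ∘L .inr ℝ ℝ (Fin k → ℝ) :
      (Fin k → ℝ) →ₗ[ℝ] (Fin k → ℝ)) hinj)).ne_zero

theorem lyapunov_eq_iff_secondOrderMap_eq (hk : 1 ≤ k) {s : ℝ} (hs : s ≠ 0) (x y : Fin k → ℝ) :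
    lyapunov (ofFirstHalf (s • x)) = lyapunov (ofFirstHalf (s • y)) ↔
      secondOrderMap k (s, x) = secondOrderMap k (s, y) := by
  constructor
  · intro h
    ext m
    have h1 := eval_lyapunov_smul s x m
    rw [h, eval_lyapunov_smul] at h1
    exact (mul_left_cancel₀ (pow_ne_zero 2 hs) (add_left_cancel h1)).symm
  · intro h
    have h1 := nodeEval_coeffMap_smul hk s x
    rw [h, ← nodeEval_coeffMap_smul hk] at h1
    have h2 := injective_of_det_ne_zero (det_nodeEval_ne_zero injective_node_sq) h1
    rw [lyapunov_ofFirstHalf hk, lyapunov_ofFirstHalf hk, h2]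

/-- Scaling by $s$ matches isospectral potentials with the level set of $G(s,\cdot)$ through $x$. -/
theorem iso_smul_eq_image (hk : 1 ≤ k) {s : ℝ} (hs : s ≠ 0) (x : Fin k → ℝ) :
    Iso (ofFirstHalf (s • x)) =
      (fun y => ofFirstHalf (s • y)) '' {y | secondOrderMap k (s, y) = secondOrderMap k (s, x)} := by
  ext p
  constructor
  · rintro ⟨hp, hspec⟩
    have h1 : s • s⁻¹ • firstHalf p = firstHalf p := smul_inv_smul₀ hs _
    refine ⟨s⁻¹ • firstHalf p, ?_, ?_⟩
    · rw [Set.mem_ofPred_eq, ← lyapunov_eq_iff_secondOrderMap_eq hk hs, h1, ofFirstHalf_firstHalf hp]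
      exact ((spectrum_eq_iff hk _ _).1 hspec).symm
    · simp only
      rw [h1, ofFirstHalf_firstHalf hp]
  · rintro ⟨y, hy, rfl⟩
    refine ⟨ofFirstHalf_mem _, (spectrum_eq_iff hk _ _).2 ?_⟩
    exact (lyapunov_eq_iff_secondOrderMap_eq hk hs _ _).2 (Eq.symm hy)

theorem ncard_iso_smul (hk : 1 ≤ k) {s : ℝ} (hs : s ≠ 0) (x : Fin k → ℝ) :
    (Iso (ofFirstHalf (s • x))).ncard =
      {y | secondOrderMap k (s, y) = secondOrderMap k (s, x)}.ncard := by
  rw [iso_smul_eq_image hk hs, Set.ncard_image_of_injective]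
  intro y z h
  have h1 := congrArg firstHalf h
  simp only [firstHalf_ofFirstHalf] at h1
  exact smul_right_injective _ hs h1

theorem sineMap_ne_zero {x : Fin k → ℝ} {m : Fin k}
    (h : sineCoord (ofFirstHalf x) ((m : ℕ) + 1) ≠ 0) : sineMap k x m ≠ 0 := by
  intro h0
  refine h ?_
  have h1 : sineCoord (ofFirstHalf x) ((m : ℕ) + 1) =
      (if (m : ℕ) + 1 = k then 1 / √2 else 1) / √(k : ℝ) * sineSum x m := by
    rw [sineCoord, sineSum, Finset.mul_sum]
    refine Finset.sum_congr rfl fun i _ => ?_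
    have harg : (2 * (((i : ℕ) : ℝ) + 1) - 1) * ((m : ℕ) + 1 : ℕ) * Real.pi / (2 * k) =
        (2 * (i : ℕ) + 1) * nodeAngle m := by
      unfold nodeAngle
      ring
    rw [sineVec, harg]
    ring
  rw [h1, ← sineMap_apply, h0, mul_zero]

theorem firstHalf_smul (s : ℝ) (q : Fin (2 * k) → ℝ) : firstHalf (s • q) = s • firstHalf q := rfl

end Isospectral

end OddSchrodinger

/-! ### Assembly of the three statements -/

open OddSchrodinger
theorem theorem1p2 (k : ℕ) (hk : 1 ≤ k) (q : Fin (2 * k) → ℝ) (hq : q ∈ oddPotentials k) :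
    ((DifferentiableAt ℝ (heightMap k) (firstHalf q) ∧
        (fderiv ℝ (heightMap k) (firstHalf q)).det ≠ 0) ↔ q ∉ surface k) ∧
    (q ∉ surface k →
      (∀ n ∈ Finset.Icc 1 k, 0 < height q n) ∧
      ∀ n ∈ Finset.Icc 1 (2 * k - 1), gapLeft q n < gapRight q n) ∧
    ((∀ m ∈ Finset.Icc 1 k, sineCoord q m ≠ 0) →
      ∃ τ : ℝ, 0 < τ ∧ ∀ s ∈ Set.Ioo 0 τ, s • q ∉ surface k ∧ (Iso (s • q)).ncard = 2 ^ k) := by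
  have hsurf : ∀ p ∈ oddPotentials k,
      p ∉ surface k ↔ (fderiv ℝ (coeffMap k) (firstHalf p)).det ≠ 0 := by
    intro p hp
    simp [surface, hp]
  rw [hsurf q hq]
  refine ⟨heightMap_differentiable_iff hk _, fun h => ?_, fun h => ?_⟩
  · have := gaps_open hk h
    rwa [ofFirstHalf_firstHalf hq] at this
  · set x := firstHalf q with hxdef
    have hqx : q = ofFirstHalf x := (ofFirstHalf_firstHalf hq).symm
    have hx : ∀ m, sineMap k x m ≠ 0 := fun m => sineMap_ne_zero (by
      rw [← hqx]
      exact h _ (Finset.mem_Icc.2 ⟨by omega, m.isLt⟩))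
    -- One radius serves both the count of solutions and the nonvanishing of the Jacobian.
    obtain ⟨τ, hτ, hball⟩ := Metric.eventually_nhds_iff.1
      ((eventually_ncard_secondOrderMap_eq hk hx).and (eventually_det_secondOrderMap_ne_zero hk hx))
    refine ⟨τ, hτ, fun s hs => ?_⟩
    have hs0 : s ≠ 0 := hs.1.ne'
    obtain ⟨h1, h2⟩ := hball (y := s) (by
      rw [Real.dist_eq, sub_zero, abs_of_pos hs.1]
      exact hs.2)
    refine ⟨(hsurf _ ((oddPotentials k).smul_mem s hq)).2 ?_, ?_⟩
    · rw [firstHalf_smul]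
      exact det_fderiv_coeffMap_smul_ne_zero hk hs0 h2
    · rw [hqx, ← ofFirstHalf_smul, ncard_iso_smul hk hs0, h1]
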